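/- **Conventions.** For $c\ge 1$ and $r\ge 0$ let $\mathrm N^c_r=\mathrm F_r/\Gamma_{c+1}(\mathrm F_r)$ be the free nilpotent group of class $c$ on $r$ generators, where $\Gamma_1(G)=G$ and $\Gamma_{n+1}(G)=[G,\Gamma_n(G)]$. The groups $\mathrm{Aut}(\mathrm N^c_r)$ form a sequence $\mathrm{Aut}(\mathrm N^c_\bullet)$ of groups by extending an automorphism so that the new generator is fixed, and likewise $\mathrm{GL}_\bullet(\mathbb Z)$, with $A\mapsto A\oplus 1$. A module over a sequence of groups $G_0\to G_1\to\cdots$ is a sequence $M_0\to M_1\to\cdots$ of abelian groups with additive $G_r$-actions on $M_r$ such that each $M_r\to M_{r+1}$ is equivariant along $G_r\to G_{r+1}$; isomorphisms of modules are equivariant and compatible with the structure maps. Let $\mathbb Z^\bullet$ be the standard $\mathrm{GL}_\bullet(\mathbb Z)$-module and $\overline{\mathbb Z}^\bullet$ the same sequence with $A$ acting by its inverse transpose (structure maps: the standard inclusions). A $\mathrm{GL}_\bullet(\mathbb Z)$-module is *polynomial* if it is isomorphic to $F(\mathbb Z^\bullet,\overline{\mathbb Z}^\bullet)$ for some functor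 $F$ from pairs of abelian groups to abelian groups that is polynomial of some finite degree $\le n$, i.e. whose cross effects (equivalently, deviations) of order $n+1$ vanish. An $\mathrm{Aut}(\mathrm N^c_\bullet)$-module is *polynomial* if it is isomorphic to the restriction of a polynomial $\mathrm{GL}_\bullet(\mathbb Z)$-module along the abelianization homomorphism $\mathrm{Aut}(\mathrm N^c_\bullet)\to\mathrm{Aut}(\mathrm N^1_\bullet)=\mathrm{GL}_\bullet(\mathbb Z)$. Let $K_r=\mathrm{Hom}(\mathrm H_1(\mathrm N^c_r;\mathbb Z),\mathrm H_2(\mathrm N^c_r;\mathbb Z))$, with $\alpha\in\mathrm{Aut}(\mathrm N^c_r)$ acting by $f\mapsto \mathrm H_2(\alpha)\circ f\circ \mathrm H_1(\alpha)^{-1}$, and with the maps $K_r\to K_{r+1}$, $f\mapsto \mathrm H_2(i)\circ f\circ\mathrm H_1(p)$, where $i\colon\mathrm N^c_r\to\mathrm N^c_{r+1}$ is the inclusion of the first $r$ generators and $p\colon\mathrm N^c_{r+1}\to\mathrm N^c_r$ kills the last generator and fixes the others. For an $\mathrm{Aut}(\mathrm N^c_\bullet)$-module $M_\bullet$ and $t\ge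 0$, the group homology $\mathrm H_t(K_r;M_r)$, where $K_r$ acts trivially on $M_r$, carries the action of $\mathrm{Aut}(\mathrm N^c_r)$ induced by its actions on $K_r$ and $M_r$; with the maps induced by $K_r\to K_{r+1}$ and $M_r\to M_{r+1}$, these groups form an $\mathrm{Aut}(\mathrm N^c_\bullet)$-module. **Proposition.** For all integers $c\ge 1$ and $t\ge 0$ and every polynomial $\mathrm{Aut}(\mathrm N^c_\bullet)$-module $M_\bullet$, the $\mathrm{Aut}(\mathrm N^c_\bullet)$-module $$\mathrm H_t\bigl(\mathrm{Hom}(\mathrm H_1(\mathrm N^c_\bullet;\mathbb Z),\mathrm H_2(\mathrm N^c_\bullet;\mathbb Z));M_\bullet\bigr)$$ is polynomial as well. -/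

import Mathlib

open CategoryTheory

noncomputable section

/-! ### Sequences of groups and their modules -/

/-- A sequence of groups `G 0 ⟶ G 1 ⟶ G 2 ⟶ ⋯`. -/
structure GroupSeq where
  obj : ℕ → Type
  [grp : ∀ r, Group (obj r)]
  map : ∀ r, obj r →* obj (r + 1)

attribute [instance] GroupSeq.grp

/-- A morphism of sequences of groups. -/
structure GroupSeq.Hom (G H : GroupSeq) where
  app : ∀ r, G.obj r →* H.obj r
  comm : ∀ r g, app (r + 1) (G.map r g) = H.map r (app r g)

/-- A module over a sequence of groups `G`: a sequence of abelian groups `M 0 ⟶ M 1 ⟶ ⋯` with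
additive actions of `G r` on `M r`, such that `M r ⟶ M (r + 1)` is equivariant with respect to
`G r ⟶ G (r + 1)`. -/
structure SeqModule (G : GroupSeq) where
  obj : ℕ → Type
  [ab : ∀ r, AddCommGroup (obj r)]
  act : ∀ r, G.obj r →* AddMonoid.End (obj r)
  map : ∀ r, obj r →+ obj (r + 1)
  equivariant : ∀ r g x, map r (act r g x) = act (r + 1) (G.map r g) (map r x)

attribute [instance] SeqModule.ab

/-- Two modules over a sequence of groups are isomorphic: there are equivariant isomorphisms
`M r ≅ N r` which commute with the structure maps. -/
def SeqModule.IsIsomorphic {G : GroupSeq} (M N : SeqModule G) : Prop :=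
  ∃ e : ∀ r, M.obj r ≃+ N.obj r,
    (∀ r g x, e r (M.act r g x) = N.act r g (e r x)) ∧
    (∀ r x, e (r + 1) (M.map r x) = N.map r (e r x))

/-- Restriction of a module along a morphism of sequences of groups. -/
def SeqModule.restrict {G H : GroupSeq} (q : G.Hom H) (M : SeqModule H) : SeqModule G where
  obj := M.obj
  act r := (M.act r).comp (q.app r)
  map := M.map
  equivariant r g x := by
    simp only [MonoidHom.comp_apply, q.comm]
    exact M.equivariant r (q.app r g) x

/-! ### Polynomial functors of pairs of abelian groups -/

/-- A functor from pairs of abelian groups to abelian groups is polynomial of degree at most `n`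
(Eilenberg and Mac Lane) if its deviations of order `n + 1` vanish: for any `n + 1` parallel
morphisms `φ i = (f i, g i)` of pairs, `∑ S, (-1) ^ |S| F (∑ i ∈ S, φ i) = 0`, where `S` runs
through all the subsets of the index set.  Equivalently, the cross effects of `F` of order
`n + 1` vanish. -/
def IsPolynomialOfDegreeLE (F : AddCommGrpCat.{0} × AddCommGrpCat.{0} ⥤ AddCommGrpCat.{0})
    (n : ℕ) : Prop :=
  ∀ ⦃A A' B B' : AddCommGrpCat.{0}⦄ (f : Fin (n + 1) → (A ⟶ A')) (g : Fin (n + 1) → (B ⟶ B')),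
    ∑ S : Finset (Fin (n + 1)),
      (-1 : ℤ) ^ S.card • F.map (Prod.mkHom (∑ i ∈ S, f i) (∑ i ∈ S, g i)) = 0

/-- A functor from pairs of abelian groups to abelian groups is polynomial if it is polynomial of
some finite degree. -/
def IsPolynomialFunctor (F : AddCommGrpCat.{0} × AddCommGrpCat.{0} ⥤ AddCommGrpCat.{0}) : Prop :=
  ∃ n, IsPolynomialOfDegreeLE F n

/-! ### The general linear groups over the integers -/

/-- The matrix `A ⊕ 1`. -/
def stabMatrix (r : ℕ) :
    Matrix (Fin r) (Fin r) ℤ →* Matrix (Fin (r + 1)) (Fin (r + 1)) ℤ where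
  toFun A := Matrix.reindex finSumFinEquiv finSumFinEquiv
    (Matrix.fromBlocks A 0 0 (1 : Matrix (Fin 1) (Fin 1) ℤ))
  map_one' := by simp
  map_mul' A B := by
    simp [Matrix.submatrix_mul_equiv, Matrix.fromBlocks_multiply]

/-- The sequence of the groups `GL_r(ℤ)`, with the maps `A ↦ A ⊕ 1`. -/
def GLSeq : GroupSeq where
  obj r := GL (Fin r) ℤ
  map r := Units.map (stabMatrix r)

/-- The inclusion of `ℤ ^ r` into `ℤ ^ (r + 1)` as the vectors with last coordinate `0`. -/
def stdIncl (r : ℕ) : (Fin r → ℤ) →+ (Fin (r + 1) → ℤ) where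
  toFun v := Fin.snoc (α := fun _ => ℤ) v 0
  map_zero' := by
    ext i; refine Fin.lastCases ?_ (fun j => ?_) i <;> simp
  map_add' v w := by
    ext i; refine Fin.lastCases ?_ (fun j => ?_) i <;> simp

/-- The action of a matrix on `ℤ ^ r`, as a morphism of abelian groups. -/
def matHom {r : ℕ} (A : Matrix (Fin r) (Fin r) ℤ) :
    AddCommGrpCat.of (Fin r → ℤ) ⟶ AddCommGrpCat.of (Fin r → ℤ) :=
  AddCommGrpCat.ofHom (Matrix.mulVecLin A).toAddMonoidHom

/-- The pair of abelian groups underlying the pair formed by the standard module `ℤ ^ r` and its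
inverse transpose. -/
abbrev stdPair (r : ℕ) : AddCommGrpCat.{0} × AddCommGrpCat.{0} :=
  (AddCommGrpCat.of (Fin r → ℤ), AddCommGrpCat.of (Fin r → ℤ))

/-- `A ∈ GL_r(ℤ)` acts on the first entry of the pair through `A`, and on the second one through
the inverse transpose of `A`. -/
def pairHom {r : ℕ} (A : GL (Fin r) ℤ) : stdPair r ⟶ stdPair r :=
  Prod.mkHom (matHom (A : Matrix (Fin r) (Fin r) ℤ))
    (matHom (Matrix.transpose ((A⁻¹ : GL (Fin r) ℤ) : Matrix (Fin r) (Fin r) ℤ)))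

/-- The structure map of the pair: the standard inclusion in both entries. -/
def pairIncl (r : ℕ) : stdPair r ⟶ stdPair (r + 1) :=
  Prod.mkHom (AddCommGrpCat.ofHom (stdIncl r)) (AddCommGrpCat.ofHom (stdIncl r))

theorem matHom_one (r : ℕ) : matHom (1 : Matrix (Fin r) (Fin r) ℤ) = 𝟙 _ := by
  refine AddCommGrpCat.hom_ext (AddMonoidHom.ext fun x => ?_)
  change Matrix.mulVec 1 x = x
  simp

theorem matHom_mul {r : ℕ} (A B : Matrix (Fin r) (Fin r) ℤ) :
    matHom (A * B) = matHom B ≫ matHom A := by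
  refine AddCommGrpCat.hom_ext (AddMonoidHom.ext fun x => ?_)
  change Matrix.mulVec (A * B) x = Matrix.mulVec A (Matrix.mulVec B x)
  simp

theorem pairHom_one (r : ℕ) : pairHom (1 : GL (Fin r) ℤ) = 𝟙 _ := by
  simp [pairHom, matHom_one]

theorem pairHom_mul {r : ℕ} (A B : GL (Fin r) ℤ) :
    pairHom (A * B) = pairHom B ≫ pairHom A := by
  simp [pairHom, mul_inv_rev, Matrix.transpose_mul, matHom_mul]

theorem stabMatrix_mulVec {r : ℕ} (A : Matrix (Fin r) (Fin r) ℤ) (v : Fin r → ℤ) :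
    (stabMatrix r A).mulVec (stdIncl r v) = stdIncl r (A.mulVec v) := by
  ext i
  refine Fin.lastCases ?_ (fun j => ?_) i <;>
  simp [stabMatrix, stdIncl, Matrix.mulVec, dotProduct, Fin.sum_univ_castSucc]

theorem stabMatrix_transpose {r : ℕ} (A : Matrix (Fin r) (Fin r) ℤ) :
    (stabMatrix r A).transpose = stabMatrix r A.transpose := by
  simp [stabMatrix, Matrix.fromBlocks_transpose]

theorem stdIncl_matHom {r : ℕ} (A : Matrix (Fin r) (Fin r) ℤ) :
    matHom A ≫ AddCommGrpCat.ofHom (stdIncl r) =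
      AddCommGrpCat.ofHom (stdIncl r) ≫ matHom (stabMatrix r A) :=
  AddCommGrpCat.hom_ext (AddMonoidHom.ext fun x => (stabMatrix_mulVec A x).symm)

theorem pairHom_pairIncl {r : ℕ} (A : GL (Fin r) ℤ) :
    pairHom A ≫ pairIncl r = pairIncl r ≫ pairHom (Units.map (stabMatrix r) A) := by
  simp only [pairHom, pairIncl, prod_comp, stdIncl_matHom, ← map_inv, Units.coe_map,
    stabMatrix_transpose]

/-- The action of `GL_r(ℤ)` on `F(ℤ^r, ℤ̄^r)`. -/
def functorAct (F : AddCommGrpCat.{0} × AddCommGrpCat.{0} ⥤ AddCommGrpCat.{0}) (r : ℕ) :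
    GL (Fin r) ℤ →* AddMonoid.End (F.obj (stdPair r)) where
  toFun A := (F.map (pairHom A)).hom
  map_one' := by rw [pairHom_one, F.map_id]; rfl
  map_mul' A B := by rw [pairHom_mul, F.map_comp]; rfl

/-- The `GL_•(ℤ)`-module `F(ℤ^•, ℤ̄^•)` given by a functor `F` of pairs of abelian groups, where
`ℤ^•` is the standard module, and `ℤ̄^•` is its inverse transpose. -/
def functorModule (F : AddCommGrpCat.{0} × AddCommGrpCat.{0} ⥤ AddCommGrpCat.{0}) :
    SeqModule GLSeq where
  obj r := F.obj (stdPair r)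
  act r := functorAct F r
  map r := (F.map (pairIncl r)).hom
  equivariant r A x := by
    have h := congrArg F.map (pairHom_pairIncl A)
    rw [F.map_comp, F.map_comp] at h
    exact ConcreteCategory.congr_hom h x

/-- A `GL_•(ℤ)`-module is polynomial if it is isomorphic to `F(ℤ^•, ℤ̄^•)` for a polynomial
functor `F`. -/
def IsPolynomialGLModule (M : SeqModule GLSeq) : Prop :=
  ∃ F : AddCommGrpCat.{0} × AddCommGrpCat.{0} ⥤ AddCommGrpCat.{0},
    IsPolynomialFunctor F ∧ M.IsIsomorphic (functorModule F)

/-! ### Free nilpotent groups -/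

/-- The free nilpotent group `N_r^c = F_r / Γ_{c+1}(F_r)` of class `c` on `r` generators.  The
subgroup `Γ_{c+1}(F_r)` is the term with index `c` of Mathlib's lower central series, which starts
with the full group at the index `0`. -/
abbrev FreeNilpotent (c r : ℕ) : Type :=
  FreeGroup (Fin r) ⧸ (⊤ : Subgroup (FreeGroup (Fin r))).lowerCentralSeries c

namespace FreeNilpotent

variable {c r : ℕ}

/-- The generators of the free nilpotent group. -/
def gen (i : Fin r) : FreeNilpotent c r := QuotientGroup.mk (FreeGroup.of i)

theorem hom_ext {H : Type*} [Group H] {f g : FreeNilpotent c r →* H}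
    (h : ∀ i, f (gen i) = g (gen i)) : f = g :=
  QuotientGroup.monoidHom_ext _ (FreeGroup.ext_hom _ _ h)

theorem lift_aux {H : Type*} [Group H] (hH : (⊤ : Subgroup H).lowerCentralSeries c = ⊥)
    (f : FreeGroup (Fin r) →* H) (x : FreeGroup (Fin r))
    (hx : x ∈ (⊤ : Subgroup (FreeGroup (Fin r))).lowerCentralSeries c) : f x = 1 := by
  have h1 : f x ∈ ((⊤ : Subgroup (FreeGroup (Fin r))).lowerCentralSeries c).map f :=
    Subgroup.mem_map_of_mem f hx
  rw [Subgroup.map_lowerCentralSeries] at h1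
  have h2 : ∀ n, ((⊤ : Subgroup (FreeGroup (Fin r))).map f).lowerCentralSeries n ≤
      (⊤ : Subgroup H).lowerCentralSeries n := by
    intro n
    induction n with
    | zero => exact le_top
    | succ n ih => exact Subgroup.commutator_mono ih le_top
  have h3 := h2 c h1
  rwa [hH, Subgroup.mem_bot] at h3

/-- The universal property of the free nilpotent group: homomorphisms to groups that are nilpotent
of class at most `c` can be prescribed on the generators. -/
def lift {H : Type*} [Group H] (hH : (⊤ : Subgroup H).lowerCentralSeries c = ⊥) (f : Fin r → H) :
    FreeNilpotent c r →* H :=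
  QuotientGroup.lift _ (FreeGroup.lift f) (fun x hx => lift_aux hH _ x hx)

@[simp] theorem lift_gen {H : Type*} [Group H] (hH : (⊤ : Subgroup H).lowerCentralSeries c = ⊥)
    (f : Fin r → H) (i : Fin r) : lift hH f (gen i) = f i := by
  change FreeGroup.lift f (FreeGroup.of i) = f i
  simp

theorem lcs_eq_bot (c r : ℕ) : (⊤ : Subgroup (FreeNilpotent c r)).lowerCentralSeries c = ⊥ := by
  have h := Subgroup.map_lowerCentralSeries (⊤ : Subgroup (FreeGroup (Fin r)))
    (QuotientGroup.mk' ((⊤ : Subgroup (FreeGroup (Fin r))).lowerCentralSeries c)) c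
  rw [← MonoidHom.range_eq_map, QuotientGroup.range_mk'] at h
  rw [← h, QuotientGroup.map_mk'_self]

theorem lcs_eq_bot_of_comm {H : Type*} [CommGroup H] (hc : 1 ≤ c) :
    (⊤ : Subgroup H).lowerCentralSeries c = ⊥ := by
  have h1 : (⊤ : Subgroup H).lowerCentralSeries 1 = ⊥ := by
    rw [Subgroup.top_lowerCentralSeries_one]
    exact (commutator_eq_bot_iff_center_eq_top H).2 CommGroup.center_eq_top
  exact le_bot_iff.1 (h1 ▸ Subgroup.lowerCentralSeries_antitone _ hc)

/-- The inclusion `N_r^c ⟶ N_{r+1}^c` given by the first `r` generators. -/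
def incl (c r : ℕ) : FreeNilpotent c r →* FreeNilpotent c (r + 1) :=
  lift (lcs_eq_bot c (r + 1)) fun i => gen i.castSucc

/-- The projection `N_{r+1}^c ⟶ N_r^c` that sends the last generator to the neutral element, and
that fixes the other generators. -/
def proj (c r : ℕ) : FreeNilpotent c (r + 1) →* FreeNilpotent c r :=
  lift (lcs_eq_bot c r) (Fin.lastCases (motive := fun _ => FreeNilpotent c r) 1 gen)

@[simp] theorem incl_gen (i : Fin r) : incl c r (gen i) = gen i.castSucc := lift_gen _ _ _

@[simp] theorem proj_gen_castSucc (i : Fin r) : proj c r (gen i.castSucc) = gen i := by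
  simp [proj]

@[simp] theorem proj_gen_last : proj c r (gen (Fin.last r)) = 1 := by
  simp [proj]

/-- The extension of an endomorphism of `N_r^c` to `N_{r+1}^c` that fixes the last generator. -/
def stab (φ : FreeNilpotent c r →* FreeNilpotent c r) :
    FreeNilpotent c (r + 1) →* FreeNilpotent c (r + 1) :=
  lift (lcs_eq_bot c (r + 1)) (Fin.lastCases (motive := fun _ => FreeNilpotent c (r + 1))
    (gen (Fin.last r)) fun i => incl c r (φ (gen i)))

@[simp] theorem stab_gen_castSucc (φ : FreeNilpotent c r →* FreeNilpotent c r) (i : Fin r) :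
    stab φ (gen i.castSucc) = incl c r (φ (gen i)) := by
  simp [stab]

@[simp] theorem stab_gen_last (φ : FreeNilpotent c r →* FreeNilpotent c r) :
    stab φ (gen (Fin.last r)) = gen (Fin.last r) := by
  simp [stab]

theorem stab_comp_incl (φ : FreeNilpotent c r →* FreeNilpotent c r) :
    (stab φ).comp (incl c r) = (incl c r).comp φ :=
  hom_ext fun i => by simp

theorem proj_comp_stab (φ : FreeNilpotent c r →* FreeNilpotent c r) :
    (proj c r).comp (stab φ) = φ.comp (proj c r) := by
  have h : (proj c r).comp (incl c r) = MonoidHom.id _ := hom_ext fun i => by simp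
  refine hom_ext fun i => ?_
  refine Fin.lastCases ?_ (fun j => ?_) i
  · simp
  · simpa using DFunLike.congr_fun h (φ (gen j))

theorem stab_id : stab (MonoidHom.id (FreeNilpotent c r)) = MonoidHom.id _ :=
  hom_ext fun i => by refine Fin.lastCases ?_ (fun j => ?_) i <;> simp

theorem stab_comp (φ ψ : FreeNilpotent c r →* FreeNilpotent c r) :
    stab (φ.comp ψ) = (stab φ).comp (stab ψ) := by
  refine hom_ext fun i => ?_
  refine Fin.lastCases ?_ (fun j => ?_) i
  · simp
  · simpa using (DFunLike.congr_fun (stab_comp_incl φ) (ψ (gen j))).symm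

/-- The homomorphism `Aut(N_r^c) ⟶ Aut(N_{r+1}^c)`: an automorphism is extended so that the last
generator is fixed. -/
def stabAut (c r : ℕ) : MulAut (FreeNilpotent c r) →* MulAut (FreeNilpotent c (r + 1)) where
  toFun α := MonoidHom.toMulEquiv (stab α.toMonoidHom) (stab (α⁻¹).toMonoidHom)
    (by
      rw [← stab_comp, ← stab_id]
      congr 1
      exact MonoidHom.ext fun x => α.symm_apply_apply x)
    (by
      rw [← stab_comp, ← stab_id]
      congr 1
      exact MonoidHom.ext fun x => α.apply_symm_apply x)
  map_one' := MulEquiv.ext fun x => DFunLike.congr_fun (stab_id (c := c) (r := r)) x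
  map_mul' α β := MulEquiv.ext fun x =>
    DFunLike.congr_fun (stab_comp α.toMonoidHom β.toMonoidHom) x

/-- The abelianization `N_r^c ⟶ ℤ ^ r`, written multiplicatively, for `c ≥ 1`. -/
def abel (hc : 1 ≤ c) : FreeNilpotent c r →* Multiplicative (Fin r → ℤ) :=
  lift (lcs_eq_bot_of_comm hc) fun i => Multiplicative.ofAdd (Pi.single i 1)

@[simp] theorem abel_gen (hc : 1 ≤ c) (i : Fin r) :
    abel hc (gen i : FreeNilpotent c r) = Multiplicative.ofAdd (Pi.single i 1) :=
  lift_gen _ _ _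

/-- The matrix of the endomorphism of `ℤ ^ r` induced by an endomorphism of `N_r^c`. -/
def abelMatrix (hc : 1 ≤ c) (φ : FreeNilpotent c r →* FreeNilpotent c r) :
    Matrix (Fin r) (Fin r) ℤ :=
  Matrix.of fun i j => (abel hc (φ (gen j))).toAdd i

theorem abel_apply (hc : 1 ≤ c) (φ : FreeNilpotent c r →* FreeNilpotent c r)
    (x : FreeNilpotent c r) :
    (abel hc (φ x)).toAdd = (abelMatrix hc φ).mulVec (abel hc x).toAdd := by
  have h : (abel hc).comp φ =
      (AddMonoidHom.toMultiplicative (Matrix.mulVecLin (abelMatrix hc φ)).toAddMonoidHom).comp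
        (abel hc) := by
    refine hom_ext fun i => ?_
    apply Multiplicative.toAdd.injective
    ext j
    simp [abelMatrix]
  exact congrArg Multiplicative.toAdd (DFunLike.congr_fun h x)

/-- The homomorphism `Aut(N_r^c) ⟶ Aut(N_r^1) = GL_r(ℤ)`: the action on the abelianization. -/
def toGL (hc : 1 ≤ c) (r : ℕ) : MulAut (FreeNilpotent c r) →* GL (Fin r) ℤ :=
  MonoidHom.toHomUnits
    { toFun := fun α => abelMatrix hc α.toMonoidHom
      map_one' := by
        ext i j
        simp [abelMatrix, Matrix.one_apply, Pi.single_apply]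
      map_mul' := fun α β => by
        ext i j
        have h := congrFun (abel_apply hc α.toMonoidHom (β (gen j))) i
        simpa [abelMatrix, Matrix.mul_apply, Matrix.mulVec, dotProduct] using h }

theorem abel_incl (hc : 1 ≤ c) (x : FreeNilpotent c r) :
    (abel hc (incl c r x)).toAdd = stdIncl r (abel hc x).toAdd := by
  have h : (abel hc).comp (incl c r) =
      (AddMonoidHom.toMultiplicative (stdIncl r)).comp (abel hc) := by
    refine hom_ext fun i => ?_
    apply Multiplicative.toAdd.injective
    ext j
    refine Fin.lastCases ?_ (fun k => ?_) j <;> simp [stdIncl, Pi.single_apply]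
  exact congrArg Multiplicative.toAdd (DFunLike.congr_fun h x)

theorem abelMatrix_stab (hc : 1 ≤ c) (φ : FreeNilpotent c r →* FreeNilpotent c r) :
    abelMatrix hc (stab φ) = stabMatrix r (abelMatrix hc φ) := by
  ext i j
  refine Fin.lastCases ?_ (fun k => ?_) j
  · refine Fin.lastCases ?_ (fun l => ?_) i <;>
    simp [abelMatrix, stabMatrix]
  · refine Fin.lastCases ?_ (fun l => ?_) i <;>
    simp [abelMatrix, stabMatrix, abel_incl, stdIncl]

end FreeNilpotent

/-- The sequence of the automorphism groups `Aut(N_r^c)`. -/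
def AutSeq (c : ℕ) : GroupSeq where
  obj r := MulAut (FreeNilpotent c r)
  map r := FreeNilpotent.stabAut c r

/-- The morphism `Aut(N_•^c) ⟶ Aut(N_•^1) = GL_•(ℤ)` of sequences of groups, for `c ≥ 1`. -/
def autToGL {c : ℕ} (hc : 1 ≤ c) : (AutSeq c).Hom GLSeq where
  app r := FreeNilpotent.toGL hc r
  comm _ g := Units.ext (FreeNilpotent.abelMatrix_stab hc (MulEquiv.toMonoidHom g))

/-- An `Aut(N_•^c)`-module is polynomial if it is (isomorphic to) the restriction of a polynomial
`GL_•(ℤ)`-module. -/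
def IsPolynomialAutModule {c : ℕ} (hc : 1 ≤ c) (M : SeqModule (AutSeq c)) : Prop :=
  ∃ P : SeqModule GLSeq, IsPolynomialGLModule P ∧ M.IsIsomorphic (P.restrict (autToGL hc))

/-! ### Homology -/

/-- The group homology `H_t(G; A)` of a group `G` with coefficients in an abelian group `A` with
the trivial action. -/
abbrev TrivHomology (G A : Type) [Group G] [AddCommGroup A] (t : ℕ) : Type :=
  groupHomology (Rep.trivial ℤ G A) t

/-- The homomorphism `H_t(G; A) ⟶ H_t(G'; A')` induced by homomorphisms `G ⟶ G'` and `A ⟶ A'`. -/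
def TrivHomology.map {G G' A A' : Type} [Group G] [Group G'] [AddCommGroup A] [AddCommGroup A']
    (f : G →* G') (a : A →+ A') (t : ℕ) : TrivHomology G A t →+ TrivHomology G' A' t :=
  (groupHomology.map (A := Rep.trivial ℤ G A) (B := Rep.trivial ℤ G' A') f
    (Rep.ofHom ⟨a.toIntLinearMap, fun _ => rfl⟩) t).hom.toAddMonoidHom

theorem TrivHomology.map_id {G A : Type} [Group G] [AddCommGroup A] (t : ℕ) :
    TrivHomology.map (MonoidHom.id G) (AddMonoidHom.id A) t = AddMonoidHom.id _ := by
  ext x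
  exact ConcreteCategory.congr_hom (groupHomology.map_id (A := Rep.trivial ℤ G A) t) x

theorem TrivHomology.map_comp {G G' G'' A A' A'' : Type} [Group G] [Group G'] [Group G'']
    [AddCommGroup A] [AddCommGroup A'] [AddCommGroup A'']
    (f : G →* G') (f' : G' →* G'') (a : A →+ A') (a' : A' →+ A'') (t : ℕ) :
    TrivHomology.map (f'.comp f) (a'.comp a) t =
      (TrivHomology.map f' a' t).comp (TrivHomology.map f a t) := by
  ext x
  exact ConcreteCategory.congr_hom (groupHomology.map_comp (A := Rep.trivial ℤ G A)
    (B := Rep.trivial ℤ G' A') (C := Rep.trivial ℤ G'' A'') f f'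
    (Rep.ofHom ⟨a.toIntLinearMap, fun _ => rfl⟩) (Rep.ofHom ⟨a'.toIntLinearMap, fun _ => rfl⟩) t) x

/-- The integral homology `H_n(G; ℤ)`. -/
abbrev IntHomology (G : Type) [Group G] (n : ℕ) : Type := TrivHomology G ℤ n

/-- The homomorphism induced by a group homomorphism on the integral homology. -/
abbrev IntHomology.map {G G' : Type} [Group G] [Group G'] (f : G →* G') (n : ℕ) :
    IntHomology G n →+ IntHomology G' n :=
  TrivHomology.map f (AddMonoidHom.id ℤ) n

theorem IntHomology.map_comp {G G' G'' : Type} [Group G] [Group G'] [Group G'']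
    (f : G →* G') (f' : G' →* G'') (n : ℕ) :
    IntHomology.map (f'.comp f) n = (IntHomology.map f' n).comp (IntHomology.map f n) :=
  TrivHomology.map_comp f f' (AddMonoidHom.id ℤ) (AddMonoidHom.id ℤ) n

/-! ### The groups `Hom(H_1(N_r^c; ℤ), H_2(N_r^c; ℤ))` -/

/-- The abelian group `Hom(H_1(N_r^c; ℤ), H_2(N_r^c; ℤ))`, written multiplicatively. -/
abbrev HomH1H2 (c r : ℕ) : Type :=
  Multiplicative (IntHomology (FreeNilpotent c r) 1 →+ IntHomology (FreeNilpotent c r) 2)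

/-- For homomorphisms `p : N_s^c ⟶ N_r^c` and `i : N_r^c ⟶ N_s^c`, the homomorphism
`f ↦ H_2(i) ∘ f ∘ H_1(p)`. -/
def HomH1H2.map {c r s : ℕ} (p : FreeNilpotent c s →* FreeNilpotent c r)
    (i : FreeNilpotent c r →* FreeNilpotent c s) : HomH1H2 c r →* HomH1H2 c s where
  toFun f := Multiplicative.ofAdd (((IntHomology.map i 2).comp f.toAdd).comp (IntHomology.map p 1))
  map_one' := by
    apply Multiplicative.toAdd.injective
    ext x
    simp
  map_mul' f g := by
    apply Multiplicative.toAdd.injective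
    ext x
    simp

theorem HomH1H2.map_id (c r : ℕ) :
    HomH1H2.map (MonoidHom.id (FreeNilpotent c r)) (MonoidHom.id _) = MonoidHom.id _ := by
  refine MonoidHom.ext fun f => ?_
  simp only [HomH1H2.map, IntHomology.map, TrivHomology.map_id]
  rfl

theorem HomH1H2.map_comp {c r s u : ℕ} (p : FreeNilpotent c s →* FreeNilpotent c r)
    (i : FreeNilpotent c r →* FreeNilpotent c s) (q : FreeNilpotent c u →* FreeNilpotent c s)
    (j : FreeNilpotent c s →* FreeNilpotent c u) :
    (HomH1H2.map q j).comp (HomH1H2.map p i) = HomH1H2.map (p.comp q) (j.comp i) := by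
  refine MonoidHom.ext fun f => ?_
  simp only [HomH1H2.map, IntHomology.map_comp]
  rfl

/-- The action of an automorphism `α` of `N_r^c` on `Hom(H_1(N_r^c; ℤ), H_2(N_r^c; ℤ))`, namely
`f ↦ H_2(α) ∘ f ∘ H_1(α)⁻¹`. -/
def HomH1H2.conj {c r : ℕ} (α : MulAut (FreeNilpotent c r)) : HomH1H2 c r →* HomH1H2 c r :=
  HomH1H2.map (α⁻¹).toMonoidHom α.toMonoidHom

/-- The structure map of the sequence `Hom(H_1(N_•^c; ℤ), H_2(N_•^c; ℤ))`: a homomorphism is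
composed with the map induced by `N_r^c ⟶ N_{r+1}^c` on `H_2`, and extended by zero on the class
of the last generator in `H_1`. -/
def HomH1H2.stab (c r : ℕ) : HomH1H2 c r →* HomH1H2 c (r + 1) :=
  HomH1H2.map (FreeNilpotent.proj c r) (FreeNilpotent.incl c r)

theorem HomH1H2.conj_one (c r : ℕ) :
    HomH1H2.conj (1 : MulAut (FreeNilpotent c r)) = MonoidHom.id _ :=
  HomH1H2.map_id c r

theorem HomH1H2.conj_mul {c r : ℕ} (α β : MulAut (FreeNilpotent c r)) :
    HomH1H2.conj (α * β) = (HomH1H2.conj α).comp (HomH1H2.conj β) := by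
  rw [HomH1H2.conj, HomH1H2.conj, HomH1H2.conj, HomH1H2.map_comp, mul_inv_rev]
  rfl

theorem HomH1H2.stab_conj {c r : ℕ} (α : MulAut (FreeNilpotent c r)) :
    (HomH1H2.stab c r).comp (HomH1H2.conj α) =
      (HomH1H2.conj (FreeNilpotent.stabAut c r α)).comp (HomH1H2.stab c r) := by
  rw [HomH1H2.stab, HomH1H2.conj, HomH1H2.conj, HomH1H2.map_comp, HomH1H2.map_comp]
  congr 1
  · rw [← map_inv]
    exact (FreeNilpotent.proj_comp_stab (α⁻¹).toMonoidHom).symm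
  · exact (FreeNilpotent.stab_comp_incl α.toMonoidHom).symm

/-- The `Aut(N_•^c)`-module `H_t(Hom(H_1(N_•^c; ℤ), H_2(N_•^c; ℤ)); M_•)`.  The group
`Hom(H_1(N_r^c; ℤ), H_2(N_r^c; ℤ))` is the kernel of `Aut(N_r^{c+1}) ⟶ Aut(N_r^c)`, and therefore
it acts trivially on the `Aut(N_r^c)`-module `M_r`.  An automorphism of `N_r^c` acts through its
actions on the group and on the coefficients. -/
def homologyModule (c t : ℕ) (M : SeqModule (AutSeq c)) : SeqModule (AutSeq c) where
  obj r := TrivHomology (HomH1H2 c r) (M.obj r) t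
  act r :=
    { toFun := fun α => TrivHomology.map (HomH1H2.conj α) (M.act r α) t
      map_one' := by
        rw [map_one]
        exact (congrArg (fun f => TrivHomology.map f (AddMonoidHom.id (M.obj r)) t)
          (HomH1H2.conj_one c r)).trans (TrivHomology.map_id t)
      map_mul' := fun α β => by
        rw [map_mul]
        exact (congrArg (fun f => TrivHomology.map f ((M.act r α).comp (M.act r β)) t)
          (HomH1H2.conj_mul α β)).trans (TrivHomology.map_comp _ _ _ _ t) }
  map r := TrivHomology.map (HomH1H2.stab c r) (M.map r) t
  equivariant r α x := by
    have h1 : (M.map r).comp (M.act r α) =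
        AddMonoidHom.comp (M.act (r + 1) ((AutSeq c).map r α)) (M.map r) :=
      AddMonoidHom.ext fun y => M.equivariant r α y
    have h2 := TrivHomology.map_comp (HomH1H2.conj α) (HomH1H2.stab c r) (M.act r α) (M.map r) t
    have h3 := (congrArg₂ (fun f a => TrivHomology.map f a t) (HomH1H2.stab_conj α) h1).symm.trans h2
    exact (DFunLike.congr_fun h3 x).symm.trans
      (DFunLike.congr_fun (TrivHomology.map_comp (HomH1H2.stab c r)
        (HomH1H2.conj (FreeNilpotent.stabAut c r α)) (M.map r)
        (M.act (r + 1) ((AutSeq c).map r α)) t) x)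

end

/-! Write N for the free nilpotent group of class c on r generators. After replacing the
coefficients by F(ℤ^•, ℤ̄^•), with F polynomial of degree at most n, the task is to show that the
homology depends polynomially, and only through abelianizations, on a pair of homomorphisms ℤ^r →
ℤ^s, and then to extend the resulting functor from the pairs (ℤ^r, ℤ^r) to all pairs of abelian
groups.

The group theory concerns H₂(N). Let E be the central extension of N by the bar 2-chains modulo
boundaries, given by the tautological cocycle. Then H₂(N) sits inside the centre of E, and a
Hopf-type argument with the free group F_r places it in Γ_{c+1}(E)
(`FreeNilpotent.incl_homologyToBarQuotient_mem`). Since E modulo its centre is a quotient of N, it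
has class at most c. Hence (c+1)-fold commutators in E are central and multilinear in classes in the
abelianization of N. So H₂(φ) depends only on the abelianization of φ
(`FreeNilpotent.map_two_eq_of_abel_eq`) and is polynomial in it of degree c+1
(`FreeNilpotent.isPolyMap_map_two`). H₁ is additive, so Hom(H₁, H₂) is polynomial of degree c+2 in a
pair of homomorphisms. Its contravariant variable becomes covariant by transposition, which is why
the inverse transpose module appears.

The homological input is that H_t(K; A), for abelian K acting trivially on A, is polynomial of
degree t in K (`TrivHomology.isPolyMap_map`). This reduces to an alternating-sum identity for the
endomorphisms 1 - ∑ p_i built from orthogonal idempotents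
(`groupHomology.sum_neg_one_pow_smul_map_complEnd`), proved by dimension shifting along permutation
modules. Together with additivity in the coefficients it gives degree t(c+2) + n.

Finally, the left Kan extension along the full subcategory of standard pairs restricts back to the
given functor. It stays polynomial because any n+1 morphisms out of ℤ^r factor through inclusions
into one larger ℤ^m (`isPolynomialOfDegreeLE_kanExtension`). -/

/-- A map between abelian groups is polynomial of degree at most `n` if all its deviations of order
greater than `n` vanish. -/
def IsPolyMap {U V : Type*} [AddCommGroup U] [AddCommGroup V] (n : ℕ) (P : U → V) : Prop :=
  ∀ (ι : Type) (u : ι → U) (T : Finset ι), n < T.card →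
    ∑ S ∈ T.powerset, (-1 : ℤ) ^ S.card • P (∑ i ∈ S, u i) = 0

/-! ### Alternating sums over subsets and the calculus of polynomial maps -/

section AlternatingSums

variable {V : Type*} [AddCommGroup V] {ι : Type*}

theorem sum_powerset_insert_neg_one_pow [DecidableEq ι] {a : ι} {T : Finset ι} (ha : a ∉ T)
    (f : Finset ι → V) :
    ∑ S ∈ (insert a T).powerset, (-1 : ℤ) ^ S.card • f S =
      ∑ S ∈ T.powerset, (-1 : ℤ) ^ S.card • f S -
        ∑ S ∈ T.powerset, (-1 : ℤ) ^ S.card • f (insert a S) := by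
  rw [Finset.sum_powerset_insert ha, sub_eq_add_neg, ← Finset.sum_neg_distrib]
  congr 1
  refine Finset.sum_congr rfl fun S hS => ?_
  rw [Finset.card_insert_of_notMem fun h => ha (Finset.mem_powerset.1 hS h), pow_succ]
  simp

/-- Möbius inversion on the lattice of finite subsets, by induction on the set. -/
theorem sum_powerset_neg_one_pow_sum_powerset (c : Finset ι → V) (T : Finset ι) :
    ∑ S ∈ T.powerset, (-1 : ℤ) ^ S.card • ∑ R ∈ S.powerset, c R = (-1 : ℤ) ^ T.card • c T := by
  classical
  induction T using Finset.induction_on generalizing c with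
  | empty => simp
  | insert a T ha ih =>
    rw [sum_powerset_insert_neg_one_pow ha]
    have h : ∀ S ∈ T.powerset, (-1 : ℤ) ^ S.card • ∑ R ∈ (insert a S).powerset, c R =
        (-1 : ℤ) ^ S.card • ∑ R ∈ S.powerset, c R +
          (-1 : ℤ) ^ S.card • ∑ R ∈ S.powerset, c (insert a R) := fun S hS => by
      rw [Finset.sum_powerset_insert fun h => ha (Finset.mem_powerset.1 hS h), smul_add]
    rw [Finset.sum_congr rfl h, Finset.sum_add_distrib, ih, ih fun R => c (insert a R),
      Finset.card_insert_of_notMem ha, pow_succ]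
    simp

end AlternatingSums

namespace IsPolyMap

variable {U V V' W : Type*} [AddCommGroup U] [AddCommGroup V]
  [AddCommGroup V'] [AddCommGroup W] {m n : ℕ}

/-- The coefficients are the signed deviations, and Möbius inversion recovers P from them. Together
with the converse `of_expansion`, this turns polynomiality into a bound on the support of the
coefficients, from which products and compositions can be read off. -/
theorem exists_expansion {P : U → V} (hP : IsPolyMap n P) {ι : Type} (u : ι → U) :
    ∃ c : Finset ι → V, (∀ T, n < T.card → c T = 0) ∧
      ∀ S, P (∑ i ∈ S, u i) = ∑ T ∈ S.powerset, c T := by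
  refine ⟨fun T => (-1 : ℤ) ^ T.card •
    ∑ S ∈ T.powerset, (-1 : ℤ) ^ S.card • P (∑ i ∈ S, u i), fun T hT => ?_, fun S => ?_⟩
  · simp [hP ι u T hT]
  · rw [sum_powerset_neg_one_pow_sum_powerset, smul_smul, ← mul_pow]
    simp

theorem of_expansion {P : U → V} (h : ∀ (ι : Type) (u : ι → U), ∃ c : Finset ι → V,
    (∀ T, n < T.card → c T = 0) ∧ ∀ S, P (∑ i ∈ S, u i) = ∑ T ∈ S.powerset, c T) :
    IsPolyMap n P := by
  intro ι u T hT
  obtain ⟨c, hc, hP⟩ := h ι u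
  simp only [hP, sum_powerset_neg_one_pow_sum_powerset, hc T hT, smul_zero]

theorem add {P Q : U → V} (hP : IsPolyMap n P) (hQ : IsPolyMap n Q) :
    IsPolyMap n fun x => P x + Q x := by
  intro ι u T hT
  simp only [smul_add, Finset.sum_add_distrib, hP ι u T hT, hQ ι u T hT, add_zero]

theorem zero : IsPolyMap n fun _ : U => (0 : V) := fun ι u T hT => by simp

theorem map {P : U → V} (hP : IsPolyMap n P) (f : V →+ W) : IsPolyMap n fun x => f (P x) := by
  intro ι u T hT
  simpa using congrArg f (hP ι u T hT)

theorem neg {P : U → V} (hP : IsPolyMap n P) : IsPolyMap n fun x => - P x :=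
  hP.map (-AddMonoidHom.id V)

theorem of_injective {P : U → V} (f : V →+ W) (hf : Function.Injective f)
    (hP : IsPolyMap n fun x => f (P x)) : IsPolyMap n P := by
  intro ι u T hT
  exact hf (by simpa using hP ι u T hT)

theorem of_apply {P : U → (V →+ W)} (hP : ∀ v, IsPolyMap n fun x => P x v) : IsPolyMap n P := by
  intro ι u T hT
  ext v
  simpa [AddMonoidHom.finsetSum_apply] using hP v ι u T hT

theorem of_hom (f : U →+ V) : IsPolyMap 1 f := by
  refine of_expansion fun ι u => ⟨fun T => if T.card = 1 then ∑ i ∈ T, f (u i) else 0,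
    fun T hT => if_neg hT.ne', fun S => ?_⟩
  rw [← Finset.sum_filter, ← Finset.powersetCard_eq_filter, Finset.powersetCard_one]
  simp

/-- Multiplying two expansions and collecting the pairs (A, B) by their union T gives the
coefficients of the product; a nonzero term needs |A| ≤ m and |B| ≤ n, hence |T| ≤ m + n. -/
theorem bilin {P : U → V} {Q : U → V'} (hP : IsPolyMap m P) (hQ : IsPolyMap n Q)
    (b : V →+ V' →+ W) : IsPolyMap (m + n) fun x => b (P x) (Q x) := by
  classical
  refine of_expansion fun ι u => ?_
  obtain ⟨c, hc, hc'⟩ := hP.exists_expansion u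
  obtain ⟨d, hd, hd'⟩ := hQ.exists_expansion u
  refine ⟨fun T => ∑ A ∈ (T.powerset ×ˢ T.powerset).filter (fun A => A.1 ∪ A.2 = T),
    b (c A.1) (d A.2), fun T hT => ?_, fun S => ?_⟩
  · refine Finset.sum_eq_zero fun A hA => ?_
    have h : A.1 ∪ A.2 = T := (Finset.mem_filter.1 hA).2
    have h' := Finset.card_union_le A.1 A.2
    rw [h] at h'
    rcases lt_or_ge m A.1.card with h1 | h1
    · simp [hc _ h1]
    · simp [hd A.2 (by omega)]
  · rw [hc', hd', map_sum b, AddMonoidHom.finsetSum_apply]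
    simp_rw [map_sum]
    rw [← Finset.sum_product']
    rw [← Finset.sum_fiberwise_of_maps_to (s := S.powerset ×ˢ S.powerset) (t := S.powerset)
      (g := fun A => A.1 ∪ A.2)]
    · refine Finset.sum_congr rfl fun T hT => Finset.sum_congr ?_ fun _ _ => rfl
      ext A
      simp only [Finset.mem_filter, Finset.mem_product, Finset.mem_powerset] at hT ⊢
      constructor
      · rintro ⟨-, rfl⟩
        exact ⟨⟨Finset.subset_union_left, Finset.subset_union_right⟩, rfl⟩
      · rintro ⟨⟨h1, h2⟩, h3⟩
        exact ⟨⟨h1.trans hT, h2.trans hT⟩, h3⟩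
    · intro A hA
      simp only [Finset.mem_product, Finset.mem_powerset] at hA ⊢
      exact Finset.union_subset hA.1 hA.2

/-- P(∑ u) is a sum of coefficients indexed by subsets of size at most m. Expanding Q on that sum
yields terms indexed by families of such subsets; a family of at most n of them has a union of at
most n * m elements. -/
theorem comp {P : U → V} {Q : V → W} (hQ : IsPolyMap n Q) (hP : IsPolyMap m P) :
    IsPolyMap (n * m) fun x => Q (P x) := by
  classical
  refine of_expansion fun ι u => ?_
  obtain ⟨c, hc, hc'⟩ := hP.exists_expansion u
  -- The coefficients of P, indexed by finite subsets of ι, are themselves the family of arguments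
  -- on which Q is expanded.
  obtain ⟨d, hd, hd'⟩ := hQ.exists_expansion c
  refine ⟨fun T => ∑ A ∈ (T.powerset.filter fun R => R.card ≤ m).powerset.filter
    (fun A => A.sup id = T), d A, fun T hT => ?_, fun S => ?_⟩
  · refine Finset.sum_eq_zero fun A hA => hd A ?_
    simp only [Finset.mem_filter, Finset.mem_powerset] at hA
    by_contra! h
    have h1 : T.card ≤ A.card * m := by
      rw [← hA.2, Finset.sup_eq_biUnion]
      exact Finset.card_biUnion_le_card_mul _ _ _ fun R hR => (Finset.mem_filter.1 (hA.1 hR)).2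
    exact absurd (h1.trans (Nat.mul_le_mul_right m h)) (by omega)
  · have h1 : P (∑ i ∈ S, u i) = ∑ T ∈ S.powerset.filter (fun R => R.card ≤ m), c T := by
      rw [hc']
      refine (Finset.sum_filter_of_ne fun T _ hT => ?_).symm
      by_contra! h
      exact hT (hc T h)
    rw [h1, hd', ← Finset.sum_fiberwise_of_maps_to (t := S.powerset) (g := fun A => A.sup id)]
    · refine Finset.sum_congr rfl fun T hT => Finset.sum_congr ?_ fun _ _ => rfl
      ext A
      simp only [Finset.mem_filter, Finset.mem_powerset] at hT ⊢
      refine and_congr_left fun hA => ?_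
      subst hA
      simp only [Finset.subset_iff (s₁ := A), Finset.mem_filter, Finset.mem_powerset]
      exact ⟨fun h R hR => ⟨Finset.le_sup (f := id) hR, (h hR).2⟩,
        fun h R hR => ⟨(h hR).1.trans hT, (h hR).2⟩⟩
    · intro A hA
      simp only [Finset.mem_powerset, Finset.subset_iff (s₁ := A), Finset.mem_filter] at hA ⊢
      exact Finset.sup_le fun R hR => (hA hR).1

/-- A deviation of one order higher is the difference of two deviations at base points that differ
by the new argument. This recursion moves base points and raises the order in `of_fin`. -/
theorem sum_insert_basepoint {P : U → V} {ι : Type} [DecidableEq ι] (u : ι → U) {a : ι}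
    {T : Finset ι} (ha : a ∉ T) (w : U) :
    ∑ S ∈ (insert a T).powerset, (-1 : ℤ) ^ S.card • P (w + ∑ i ∈ S, u i) =
      ∑ S ∈ T.powerset, (-1 : ℤ) ^ S.card • P (w + ∑ i ∈ S, u i) -
        ∑ S ∈ T.powerset, (-1 : ℤ) ^ S.card • P (w + u a + ∑ i ∈ S, u i) := by
  rw [sum_powerset_insert_neg_one_pow ha fun S => P (w + ∑ i ∈ S, u i)]
  congr 1
  refine Finset.sum_congr rfl fun S hS => ?_
  rw [Finset.sum_insert fun h => ha (Finset.mem_powerset.1 hS h), add_assoc]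

/-- It suffices to consider the deviations of order exactly `n + 1`. -/
theorem of_fin {P : U → V} (h : ∀ u : Fin (n + 1) → U,
    ∑ S : Finset (Fin (n + 1)), (-1 : ℤ) ^ S.card • P (∑ i ∈ S, u i) = 0) : IsPolyMap n P := by
  classical
  intro ι
  have h0 : ∀ (u : ι → U) (T : Finset ι), T.card = n + 1 →
      ∑ S ∈ T.powerset, (-1 : ℤ) ^ S.card • P (0 + ∑ i ∈ S, u i) = 0 := by
    intro u T hT
    let e : Fin (n + 1) ≃ T := (T.equivFinOfCardEq hT).symm
    let j : Fin (n + 1) ↪ ι := e.toEmbedding.trans (Function.Embedding.subtype _)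
    have hj : Finset.univ.map j = T := by
      ext x
      simp only [Finset.mem_map, Finset.mem_univ, true_and]
      exact ⟨fun ⟨y, hy⟩ => hy ▸ (e y).2, fun hx => ⟨e.symm ⟨x, hx⟩, by simp [j]⟩⟩
    rw [← h fun i => u (j i)]
    refine (Finset.sum_bij (fun S _ => S.map j) ?_ ?_ ?_ ?_).symm
    · intro S _
      rw [Finset.mem_powerset, ← hj]
      exact Finset.map_subset_map.2 (Finset.subset_univ S)
    · intro S _ S' _ hS
      exact Finset.map_injective j hS
    · intro S hS
      rw [Finset.mem_powerset, ← hj, Finset.subset_map_iff] at hS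
      obtain ⟨S', -, rfl⟩ := hS
      exact ⟨S', Finset.mem_univ _, rfl⟩
    · intro S _
      simp
  -- Passing to an arbitrary base point w: setting the argument at a to w, and then to w + u a,
  -- shows that the deviation over the other n arguments has the same value at 0, at w and at w + u
  -- a.
  have h1 : ∀ (u : ι → U) (T : Finset ι) (w : U), T.card = n + 1 →
      ∑ S ∈ T.powerset, (-1 : ℤ) ^ S.card • P (w + ∑ i ∈ S, u i) = 0 := by
    intro u T w hT
    obtain ⟨a, T, ha, rfl, hT'⟩ := Finset.card_eq_succ.1 hT
    have hu : ∀ v w, ∑ S ∈ T.powerset, (-1 : ℤ) ^ S.card •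
        P (w + ∑ i ∈ S, Function.update u a v i) =
        ∑ S ∈ T.powerset, (-1 : ℤ) ^ S.card • P (w + ∑ i ∈ S, u i) := by
      intro v w
      refine Finset.sum_congr rfl fun S hS => ?_
      congr 3
      refine Finset.sum_congr rfl fun i hi => Function.update_of_ne ?_ _ _
      rintro rfl
      exact ha (Finset.mem_powerset.1 hS hi)
    have h2 := h0 (Function.update u a w) _ hT
    have h3 := h0 (Function.update u a (w + u a)) _ hT
    rw [sum_insert_basepoint _ ha, hu, hu, Function.update_self, zero_add] at h2 h3
    rw [sum_insert_basepoint _ ha, ← sub_eq_zero.1 h2, ← sub_eq_zero.1 h3, sub_self]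
  have h2 : ∀ (k : ℕ) (u : ι → U) (T : Finset ι) (w : U), T.card = n + 1 + k →
      ∑ S ∈ T.powerset, (-1 : ℤ) ^ S.card • P (w + ∑ i ∈ S, u i) = 0 := by
    intro k
    induction k with
    | zero => exact h1
    | succ k ih =>
      intro u T w hT
      obtain ⟨a, T, ha, rfl, hT'⟩ := Finset.card_eq_succ.1 hT
      rw [sum_insert_basepoint _ ha, ih u T w hT', ih u T _ hT', sub_self]
  intro u T hT
  simpa using h2 (T.card - (n + 1)) u T 0 (by omega)

theorem sum_univ {P : U → V} (hP : IsPolyMap n P) (u : Fin (n + 1) → U) :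
    ∑ S : Finset (Fin (n + 1)), (-1 : ℤ) ^ S.card • P (∑ i ∈ S, u i) = 0 := by
  have h := hP _ u Finset.univ (by simp)
  rwa [Finset.powerset_univ] at h

end IsPolyMap

/-! ### Tools for dimension shifting in group homology -/

namespace Rep

variable {k G : Type} [CommRing k] [Group G]

theorem shortExact_of_injective_of_surjective {X : ShortComplex (Rep.{0} k G)}
    (hf : Function.Injective X.f.hom) (hg : Function.Surjective X.g.hom)
    (h : ∀ x, X.g.hom x = 0 → ∃ y, X.f.hom y = x) : X.ShortExact where
  exact := by
    rw [← ShortComplex.exact_map_iff_of_faithful X (forget₂ (Rep.{0} k G) (ModuleCat k)),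
      ShortComplex.moduleCat_exact_iff]
    exact h
  mono_f := (Rep.mono_iff_injective _).2 hf
  epi_g := (Rep.epi_iff_surjective _).2 hg

/-- The short complex formed by a morphism of representations and its kernel. -/
noncomputable def kernelComplex {P M : Rep.{0} k G} (g : P ⟶ M) : ShortComplex (Rep.{0} k G) :=
  ShortComplex.mk
    (P.subtype (LinearMap.ker g.hom.toLinearMap) fun a x (hx : g.hom x = 0) => by
      change g.hom (P.ρ a x) = 0
      rw [Rep.hom_comm_apply, hx, map_zero]) g (by ext x; exact x.2)

theorem kernelComplex_shortExact {P M : Rep.{0} k G} (g : P ⟶ M)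
    (hg : Function.Surjective g.hom) : (kernelComplex g).ShortExact :=
  shortExact_of_injective_of_surjective Subtype.val_injective hg fun x hx => ⟨⟨x, hx⟩, rfl⟩

/-- The module induced from the trivial subgroup surjects onto M by the counit, and by Shapiro's
lemma its homology is that of the trivial group. -/
theorem exists_surjective_acyclic (M : Rep.{0} k G) : ∃ (P : Rep.{0} k G) (g : P ⟶ M),
    Function.Surjective g.hom ∧ ∀ n, Limits.IsZero (groupHomology P (n + 1)) := by
  classical
  let S : Subgroup G := ⊥
  refine ⟨Rep.ind S.subtype (Rep.res S.subtype M),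
    (Rep.indResHomEquiv S.subtype (Rep.res S.subtype M) M).symm (𝟙 _), fun x => ?_, fun n => ?_⟩
  · refine ⟨Representation.IndV.mk _ _ 1 x, ?_⟩
    simp
  · exact (isZero_groupHomology_succ_of_subsingleton (Rep.res S.subtype M) n).of_iso
      (groupHomology.indIso S _ _)

end Rep

namespace groupHomology

variable {k G H : Type} [CommRing k] [Group G] [Group H]

/-- Naturality of the connecting map when the group changes along with the short exact sequence; it
follows from naturality for the underlying complexes of chains. -/
theorem δ_naturality_of_comm {X : ShortComplex (Rep.{0} k G)} {Y : ShortComplex (Rep.{0} k H)}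
    (hX : X.ShortExact) (hY : Y.ShortExact) (f : G →* H) (τ₁ : X.X₁ ⟶ Rep.res f Y.X₁)
    (τ₂ : X.X₂ ⟶ Rep.res f Y.X₂) (τ₃ : X.X₃ ⟶ Rep.res f Y.X₃)
    (h₁ : τ₁ ≫ (Rep.resFunctor f).map Y.f = X.f ≫ τ₂)
    (h₂ : τ₂ ≫ (Rep.resFunctor f).map Y.g = X.g ≫ τ₃) (n : ℕ) :
    δ hX (n + 1) n rfl ≫ map f τ₁ n = map f τ₃ (n + 1) ≫ δ hY (n + 1) n rfl := by
  have e₁ : chainsMap f τ₁ ≫ chainsMap (MonoidHom.id H) Y.f =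
      chainsMap (MonoidHom.id G) X.f ≫ chainsMap f τ₂ := by
    rw [← chainsMap_comp, ← chainsMap_comp]
    exact chainsMap_congr rfl (congrArg (fun φ => φ.hom.toLinearMap) h₁)
  have e₂ : chainsMap f τ₂ ≫ chainsMap (MonoidHom.id H) Y.g =
      chainsMap (MonoidHom.id G) X.g ≫ chainsMap f τ₃ := by
    rw [← chainsMap_comp, ← chainsMap_comp]
    exact chainsMap_congr rfl (congrArg (fun φ => φ.hom.toLinearMap) h₂)
  let φ : X.map (chainsFunctor k G) ⟶ Y.map (chainsFunctor k H) :=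
    { τ₁ := chainsMap f τ₁, τ₂ := chainsMap f τ₂, τ₃ := chainsMap f τ₃, comm₁₂ := e₁, comm₂₃ := e₂ }
  exact HomologicalComplex.HomologySequence.δ_naturality φ (map_chainsFunctor_shortExact hX)
    (map_chainsFunctor_shortExact hY) _ _ _

end groupHomology

/-! ### Permutation modules and conjugation invariance of homology -/

section PermFinsupp

variable {k G H X V : Type} [CommRing k] [Group G] [Group H] [AddCommGroup V] [Module k V]

/-- The diagonal action on the finitely supported functions `X →₀ V` given by an action on `X`
and a representation on `V`. -/
noncomputable def Representation.permFinsupp (s : G →* Equiv.Perm X) (ρ : Representation k G V) :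
    Representation k G (X →₀ V) where
  toFun g := Finsupp.mapRange.linearMap (ρ g) ∘ₗ Finsupp.lmapDomain V k (s g)
  map_one' := by ext; simp
  map_mul' g h := by ext; simp

@[simp]
theorem Representation.permFinsupp_single (s : G →* Equiv.Perm X) (ρ : Representation k G V)
    (g : G) (x : X) (v : V) :
    ρ.permFinsupp s g (Finsupp.single x v) = Finsupp.single (s g x) (ρ g v) := by
  simp [Representation.permFinsupp]

namespace Rep

/-- The representation `X →₀ M`, where `G` acts on `M` through a homomorphism `f : G →* H`. -/
noncomputable def permFinsupp (s : G →* Equiv.Perm X) (f : G →* H) (M : Rep.{0} k H) :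
    Rep.{0} k G :=
  Rep.of (Representation.permFinsupp s (M.ρ.comp f))

/-- The functoriality of `X →₀ M` in `M`. -/
noncomputable def permFinsuppMap (s : G →* Equiv.Perm X) (f : G →* H) {M N : Rep.{0} k H}
    (φ : M ⟶ N) : permFinsupp s f M ⟶ permFinsupp s f N :=
  Rep.ofHom ⟨Finsupp.mapRange.linearMap φ.hom.toLinearMap, fun g => by
    ext x m : 2
    simp [Rep.hom_comm_apply φ]⟩

/-- The image of `X →₀ -` on a short complex. -/
noncomputable def permFinsuppComplex (s : G →* Equiv.Perm X) (f : G →* H)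
    (Y : ShortComplex (Rep.{0} k H)) : ShortComplex (Rep.{0} k G) :=
  ShortComplex.mk (permFinsuppMap s f Y.f) (permFinsuppMap s f Y.g) (by
    ext x
    refine Finsupp.ext fun i => ?_
    exact congrArg (fun φ => φ.hom ((show X →₀ Y.X₁ from x) i)) Y.zero)

theorem permFinsuppComplex_shortExact (s : G →* Equiv.Perm X) (f : G →* H)
    {Y : ShortComplex (Rep.{0} k H)} (hY : Y.ShortExact) :
    (permFinsuppComplex s f Y).ShortExact := by
  classical
  have hf := (Rep.mono_iff_injective _).1 hY.mono_f
  have hg := (Rep.epi_iff_surjective _).1 hY.epi_g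
  refine shortExact_of_injective_of_surjective (Finsupp.mapRange_injective _ (map_zero _) hf)
    (Finsupp.mapRange_surjective _ (map_zero _) hg) fun (x : X →₀ Y.X₂) hx => ?_
  have hx' : Finsupp.mapRange Y.g.hom (map_zero _) x = 0 := hx
  have h := (hY.exact.map (forget₂ (Rep.{0} k H) (ModuleCat k)))
  rw [ShortComplex.moduleCat_exact_iff] at h
  have h' : ∀ m : Y.X₂, Y.g.hom m = 0 → ∃ m', Y.f.hom m' = m := h
  choose! t ht using h'
  refine ⟨Finsupp.onFinset x.support (fun i => if x i = 0 then 0 else t (x i))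
    fun i hi => by simp at hi ⊢; exact hi.1, ?_⟩
  refine Finsupp.ext fun i => ?_
  change Y.f.hom (if x i = 0 then 0 else t (x i)) = x i
  split_ifs with h0
  · rw [h0, map_zero]
  · exact ht _ (DFunLike.congr_fun hx' i)

/-- The augmentation `X →₀ M ⟶ M`. -/
noncomputable def permFinsuppSum (s : G →* Equiv.Perm X) (f : G →* H) (M : Rep.{0} k H) :
    permFinsupp s f M ⟶ res f M :=
  Rep.ofHom ⟨Finsupp.lsum k fun _ => LinearMap.id, fun g => by
    ext x m : 2
    simp⟩

/-- The augmentation `X →₀ M ⟶ M`, twisted by a function `η : X → H` that conjugates one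
homomorphism `G →* H` to another. -/
noncomputable def permFinsuppTwistedSum (s : G →* Equiv.Perm X) (f f' : G →* H) (η : X → H)
    (hη : ∀ g x, f g * η x = η (s g x) * f' g) (M : Rep.{0} k H) :
    permFinsupp s f M ⟶ res f' M :=
  Rep.ofHom ⟨Finsupp.lsum k fun x => M.ρ (η x)⁻¹, fun g => by
    ext x m : 2
    have h : (η (s g x))⁻¹ * f g = f' g * (η x)⁻¹ := by
      rw [inv_mul_eq_iff_eq_mul, ← mul_assoc, ← hη, mul_inv_cancel_right]
    have h2 := congrArg (fun a => M.ρ a m) h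
    simp only [map_mul] at h2
    simpa using h2⟩

theorem permFinsuppSum_single (s : G →* Equiv.Perm X) (f : G →* H) (M : Rep.{0} k H) (x : X)
    (m : M) : (permFinsuppSum s f M).hom (Finsupp.single x m) = m :=
  (Finsupp.lsum_single k _ x m)

theorem permFinsuppTwistedSum_single (s : G →* Equiv.Perm X) (f f' : G →* H) (η : X → H)
    (hη : ∀ g x, f g * η x = η (s g x) * f' g) (M : Rep.{0} k H) (x : X) (m : M) :
    (permFinsuppTwistedSum s f f' η hη M).hom (Finsupp.single x m) = M.ρ (η x)⁻¹ m :=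
  (Finsupp.lsum_single k _ x m)

theorem permFinsuppMap_single (s : G →* Equiv.Perm X) (f : G →* H) {M N : Rep.{0} k H}
    (φ : M ⟶ N) (x : X) (m : M) :
    (permFinsuppMap s f φ).hom (Finsupp.single x m) = Finsupp.single x (φ.hom m) :=
  Finsupp.mapRange_single (hf := map_zero _)

theorem permFinsupp_hom_ext {s : G →* Equiv.Perm X} {f : G →* H} {M : Rep.{0} k H}
    {N : Rep.{0} k G} {φ ψ : permFinsupp s f M ⟶ N}
    (h : ∀ (x : X) (m : M), φ.hom (Finsupp.single x m) = ψ.hom (Finsupp.single x m)) : φ = ψ := by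
  refine Rep.hom_ext (Representation.IntertwiningMap.toLinearMap_injective _ _ ?_)
  exact Finsupp.lhom_ext h

theorem permFinsuppSum_naturality (s : G →* Equiv.Perm X) (f : G →* H) {M N : Rep.{0} k H}
    (φ : M ⟶ N) : permFinsuppSum s f M ≫ (resFunctor f).map φ =
      permFinsuppMap s f φ ≫ permFinsuppSum s f N :=
  permFinsupp_hom_ext fun x m => by
    change φ.hom ((permFinsuppSum s f M).hom (Finsupp.single x m)) =
      (permFinsuppSum s f N).hom ((permFinsuppMap s f φ).hom (Finsupp.single x m))
    rw [permFinsuppMap_single]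
    exact (congrArg φ.hom (permFinsuppSum_single s f M x m)).trans
      (permFinsuppSum_single s f N x _).symm

theorem permFinsuppTwistedSum_naturality (s : G →* Equiv.Perm X) (f f' : G →* H) (η : X → H)
    (hη : ∀ g x, f g * η x = η (s g x) * f' g) {M N : Rep.{0} k H} (φ : M ⟶ N) :
    permFinsuppTwistedSum s f f' η hη M ≫ (resFunctor f').map φ =
      permFinsuppMap s f φ ≫ permFinsuppTwistedSum s f f' η hη N :=
  permFinsupp_hom_ext fun x m => by
    change φ.hom ((permFinsuppTwistedSum s f f' η hη M).hom (Finsupp.single x m)) =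
      (permFinsuppTwistedSum s f f' η hη N).hom ((permFinsuppMap s f φ).hom (Finsupp.single x m))
    rw [permFinsuppMap_single]
    exact (congrArg φ.hom (permFinsuppTwistedSum_single s f f' η hη M x m)).trans
      ((Rep.hom_comm_apply φ _ _).trans
        (permFinsuppTwistedSum_single s f f' η hη N x (φ.hom m)).symm)

end Rep

/-- Conjugate homomorphisms of (action groupoids of) groups induce the same map on homology. -/
theorem groupHomology.map_permFinsuppSum_eq (s : G →* Equiv.Perm X) (f f' : G →* H) (η : X → H)
    (hη : ∀ g x, f g * η x = η (s g x) * f' g) (n : ℕ) (M : Rep.{0} k H) :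
    groupHomology.map f (Rep.permFinsuppSum s f M) n =
      groupHomology.map f' (Rep.permFinsuppTwistedSum s f f' η hη M) n := by
  -- Dimension shifting in M: both augmentations are natural in M, and an acyclic cover makes the
  -- connecting map of the target injective, so agreement in degree n gives agreement in degree n +
  -- 1.
  induction n generalizing M with
  | zero =>
    rw [← cancel_epi (H0π (Rep.permFinsupp s f M)), H0π_comp_map, H0π_comp_map]
    refine ModuleCat.hom_ext (Finsupp.lhom_ext fun x m => ?_)
    -- On the generator at x the two maps differ by the action of η x, which is invisible in
    -- coinvariants.
    have h : (Rep.permFinsuppSum s f M).hom (Finsupp.single x m) =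
        M.ρ (η x) ((Rep.permFinsuppTwistedSum s f f' η hη M).hom (Finsupp.single x m)) := by
      have h1 := congrArg (M.ρ (η x)) (Rep.permFinsuppTwistedSum_single s f f' η hη M x m)
      rw [Representation.self_inv_apply] at h1
      exact (Rep.permFinsuppSum_single s f M x m).trans h1.symm
    change H0π M ((Rep.permFinsuppSum s f M).hom (Finsupp.single x m)) =
      H0π M ((Rep.permFinsuppTwistedSum s f f' η hη M).hom (Finsupp.single x m))
    rw [h, ← coinvariantsMk_comp_H0Iso_inv]
    exact congrArg (H0Iso M).inv (Representation.Coinvariants.mk_self_apply M.ρ _ _)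
  | succ n ih =>
    obtain ⟨P, g, hg, hP⟩ := Rep.exists_surjective_acyclic M
    have hY := Rep.kernelComplex_shortExact g hg
    have hX := Rep.permFinsuppComplex_shortExact s f hY
    have := mono_δ_of_isZero hY n (hP n)
    refine (cancel_mono (δ hY (n + 1) n rfl)).1 ?_
    have h1 := δ_naturality_of_comm hX hY f _ _ _ (Rep.permFinsuppSum_naturality s f _)
      (Rep.permFinsuppSum_naturality s f _) n
    have h2 := δ_naturality_of_comm hX hY f' _ _ _
      (Rep.permFinsuppTwistedSum_naturality s f f' η hη _)
      (Rep.permFinsuppTwistedSum_naturality s f f' η hη _) n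
    exact h1.symm.trans ((congrArg _ (ih _)).trans h2)

end PermFinsupp

/-! ### Homology of abelian groups and orthogonal idempotents -/

namespace Rep

variable {k G : Type} [CommRing k] [Group G]

/-- The identity of a representation `A`, as a morphism to the restriction of `A` along an
endomorphism of the group which does not change the action. -/
noncomputable def toRes (f : G →* G) (A : Rep.{0} k G) (h : ∀ g, A.ρ (f g) = A.ρ g) :
    A ⟶ res f A :=
  Rep.ofHom ⟨LinearMap.id, fun g => (h g).symm⟩

end Rep

namespace groupHomology

open Rep

variable {k G : Type} [CommRing k] [CommGroup G] {ι : Type}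

/-- The endomorphism `1 - ∑ i ∈ S, p i`, in multiplicative notation. -/
noncomputable def complEnd (p : ι → G →* G) (S : Finset ι) : G →* G :=
  MonoidHom.id G / ∏ i ∈ S, p i

theorem complEnd_apply (p : ι → G →* G) (S : Finset ι) (g : G) :
    complEnd p S g = g / ∏ i ∈ S, p i g := by
  simp [complEnd, MonoidHom.finsetProd_apply]

theorem ρ_complEnd {A : Rep.{0} k G} {p : ι → G →* G} {S : Finset ι}
    (h : ∀ i ∈ S, ∀ g, A.ρ (p i g) = 1) (g : G) : A.ρ (complEnd p S g) = A.ρ g := by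
  have h1 : A.ρ (∏ i ∈ S, p i g) = 1 := by
    classical
    induction S using Finset.induction_on with
    | empty => simp
    | insert a S ha ih =>
      rw [Finset.prod_insert ha, map_mul, h a (Finset.mem_insert_self a S),
        ih fun i hi => h i (Finset.mem_insert_of_mem hi), one_mul]
  have h2 : complEnd p S g * ∏ i ∈ S, p i g = g := by rw [complEnd_apply, div_mul_cancel]
  conv_rhs => rw [← h2, map_mul, h1, mul_one]

/-- By orthogonality (1 - p_a)(1 - ∑_S p_i) = 1 - p_a - ∑_S p_i. -/
theorem complEnd_insert [DecidableEq ι] {p : ι → G →* G}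
    (hp : ∀ i j, i ≠ j → ∀ g, p i (p j g) = 1) {a : ι} {S : Finset ι} (ha : a ∉ S) :
    complEnd p (insert a S) = (complEnd p {a}).comp (complEnd p S) := by
  ext g
  have h : p a (∏ i ∈ S, p i g) = 1 := by
    rw [map_prod]
    exact Finset.prod_eq_one fun i hi => hp a i (fun h => ha (h ▸ hi)) g
  simp only [MonoidHom.comp_apply, complEnd_apply, Finset.prod_insert ha, Finset.prod_singleton,
    map_div, h, div_one]
  rw [div_div, mul_comm]

/-- G acts on the set G by translation through p_a. Over this G-set the identity and 1 - p_a are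
conjugate, so 1 - p_a fixes every class that comes from the permutation module. -/
theorem map_permFinsuppSum_comp_map_toRes {p : ι → G →* G} (hp : ∀ i g, p i (p i g) = p i g)
    (a : ι) (A : Rep.{0} k G) (hA : ∀ g, A.ρ (p a g) = 1) (φ : A ⟶ res (complEnd p {a}) A)
    (hφ : ∀ x, φ.hom x = x) (n : ℕ)
    (π : permFinsupp ((MulAction.toPermHom G G).comp (p a)) (MonoidHom.id G) A ⟶ A)
    (hπ : ∀ x (m : A), π.hom (Finsupp.single x m) = m) :
    map (MonoidHom.id G) π n ≫ map (complEnd p {a}) φ n = map (MonoidHom.id G) π n := by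
  have h := map_permFinsuppSum_eq ((MulAction.toPermHom G G).comp (p a)) (MonoidHom.id G)
    -- The conjugating function is η = p_a. The required identity is g · p_a(x) = p_a(p_a(g) x) · (g
    -- / p_a(g)), which uses idempotence and commutativity.
    (complEnd p {a}) (p a) (fun g x => by
      simp only [complEnd_apply, hp, MonoidHom.id_apply, MonoidHom.comp_apply,
        Finset.prod_singleton, MulAction.toPermHom_apply, MulAction.toPerm_apply, smul_eq_mul,
        map_mul, div_eq_mul_inv]
      rw [mul_comm (p a g), mul_assoc, mul_left_comm (p a g), mul_inv_cancel, mul_one, mul_comm]) n A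
  rw [← map_comp]
  refine Eq.trans ?_ (h.symm.trans ?_)
  · refine map_congr rfl (Finsupp.lhom_ext fun x m => ?_) n
    refine (hφ _).trans ((hπ x m).trans ?_)
    refine Eq.trans ?_ (permFinsuppTwistedSum_single _ _ _ _ _ A x m).symm
    rw [← map_inv, hA]
    rfl
  · refine map_congr rfl (Finsupp.lhom_ext fun x m => ?_) n
    exact (permFinsuppSum_single _ _ A x m).trans (hπ x m).symm

/-- Induction on the degree. For a in T let D be the alternating sum over subsets of T \ {a}; the
full sum is D minus D followed by 1 - p_a. The image of D is killed by the connecting map of the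
cover by the permutation module of p_a, hence comes from that module, where 1 - p_a acts as the
identity. Nontrivial actions have to be allowed because the kernel of the cover need not be a
trivial module: only the p_i with i ≠ a are known to act trivially there. -/
theorem sum_neg_one_pow_smul_map_complEnd {p : ι → G →* G} (hp : ∀ i g, p i (p i g) = p i g)
    (hp' : ∀ i j, i ≠ j → ∀ g, p i (p j g) = 1) (n : ℕ) (T : Finset ι) (hT : n < T.card)
    (A : Rep.{0} k G) (hA : ∀ i ∈ T, ∀ g, A.ρ (p i g) = 1)
    (φ : ∀ S, A ⟶ res (complEnd p S) A) (hφ : ∀ S ⊆ T, ∀ x, (φ S).hom x = x) :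
    ∑ S ∈ T.powerset, (-1 : ℤ) ^ S.card • map (complEnd p S) (φ S) n = 0 := by
  classical
  induction n generalizing T A with
  | zero =>
    have h : ∀ S ∈ T.powerset, (-1 : ℤ) ^ S.card • map (complEnd p S) (φ S) 0 =
        (-1 : ℤ) ^ S.card • 𝟙 (groupHomology A 0) := by
      intro S hS
      congr 1
      rw [← cancel_epi (H0π A), H0π_comp_map, Category.comp_id]
      ext x
      exact congrArg (H0π A) (hφ S (Finset.mem_powerset.1 hS) x)
    rw [Finset.sum_congr rfl h, ← Finset.sum_smul, Finset.sum_powerset_neg_one_pow_card,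
      if_neg (Finset.card_pos.1 hT).ne_empty, zero_smul]
  | succ n ih =>
    obtain ⟨a, T, ha, rfl, hT'⟩ := Finset.card_eq_succ.1 (Nat.succ_pred_eq_of_pos (by omega :
      0 < T.card)).symm
    rw [sum_powerset_insert_neg_one_pow ha]
    let s := (MulAction.toPermHom G G).comp (p a)
    let π : permFinsupp s (MonoidHom.id G) A ⟶ A := permFinsuppSum s (MonoidHom.id G) A
    have hX := kernelComplex_shortExact π fun m => ⟨Finsupp.single 1 m, permFinsuppSum_single _ _ _ _ _⟩
    have hφa := map_permFinsuppSum_comp_map_toRes hp a A (hA a (Finset.mem_insert_self a T)) (φ {a})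
      (hφ _ (by simp)) (n + 1) π (permFinsuppSum_single _ _ _)
    have h1 : ∀ S ∈ T.powerset, (-1 : ℤ) ^ S.card • map (complEnd p (insert a S)) (φ (insert a S)) (n + 1)
        = ((-1 : ℤ) ^ S.card • map (complEnd p S) (φ S) (n + 1)) ≫ map (complEnd p {a}) (φ {a}) (n + 1) := by
      intro S hS
      rw [Preadditive.zsmul_comp, ← map_comp]
      congr 1
      refine map_congr (complEnd_insert hp' fun h => ha (Finset.mem_powerset.1 hS h)) ?_ _
      refine LinearMap.ext fun x => ?_
      have hS' := Finset.mem_powerset.1 hS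
      refine (hφ _ (Finset.insert_subset_insert a hS') x).trans
        (Eq.symm ((hφ {a} (by simp) _).trans (hφ S (hS'.trans (Finset.subset_insert a T)) x)))
    rw [Finset.sum_congr rfl h1, ← Preadditive.sum_comp]
    -- For i ≠ a, orthogonality makes the image of p_i act trivially on the G-set, so the hypothesis
    -- of the induction passes to the kernel for the smaller set T.
    have hs : ∀ i ∈ T, ∀ g, s (p i g) = 1 := by
      intro i hi g
      ext x
      have h : p a (p i g) = 1 := hp' a i (fun h => ha (h ▸ hi)) g
      simp [s, h]
    have hB : ∀ i ∈ T, ∀ g, (permFinsupp s (MonoidHom.id G) A).ρ (p i g) = 1 := by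
      intro i hi g
      refine Finsupp.lhom_ext fun x m => ?_
      refine (Representation.permFinsupp_single s _ _ x m).trans ?_
      rw [hs i hi]
      exact congrArg (Finsupp.single x)
        (LinearMap.congr_fun (hA i (Finset.mem_insert_of_mem hi) g) m)
    have hK : ∀ i ∈ T, ∀ g, (kernelComplex π).X₁.ρ (p i g) = 1 := fun i hi g =>
      LinearMap.ext fun x => Subtype.ext (LinearMap.congr_fun (hB i hi g) x.1)
    let φ' : ∀ S, (kernelComplex π).X₁ ⟶ res (complEnd p S) (kernelComplex π).X₁ := fun S =>
      if h : S ⊆ T then toRes _ _ (ρ_complEnd fun i hi => hK i (h hi)) else 0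
    have hφ' : ∀ S (hS : S ⊆ T), φ' S = toRes _ _ (ρ_complEnd fun i hi => hK i (hS hi)) :=
      fun S hS => dif_pos hS
    have h2 := ih T (by rw [Finset.card_insert_of_notMem ha] at hT; omega) (kernelComplex π).X₁ hK φ' fun S hS x => by rw [hφ' S hS]; rfl
    obtain ⟨d, hd, hd'⟩ : ∃ d : groupHomology A (n + 1) ⟶ groupHomology (kernelComplex π).X₁ n,
        (∀ S ⊆ T, d ≫ map (complEnd p S) (φ' S) n = map (complEnd p S) (φ S) (n + 1) ≫ d) ∧
        ∀ z, d z = 0 → ∃ y, map (MonoidHom.id G) π (n + 1) y = z := by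
      refine ⟨δ hX (n + 1) n rfl, fun S hS => ?_,
        (ShortComplex.moduleCat_exact_iff _).1 (mapShortComplex₃_exact hX rfl)⟩
      refine δ_naturality_of_comm hX hX (complEnd p S) (φ' S)
        (toRes _ _ (ρ_complEnd fun i hi => hB i (hS hi))) (φ S) ?_ ?_ n
      · rw [hφ' S hS]
        rfl
      · ext x
        exact (hφ S (hS.trans (Finset.subset_insert a T)) _).symm
    -- D followed by the connecting map is the connecting map followed by the alternating sum on the
    -- kernel in degree n, which vanishes by induction.
    have h3 : (∑ S ∈ T.powerset, (-1 : ℤ) ^ S.card • map (complEnd p S) (φ S) (n + 1)) ≫ d = 0 := by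
      rw [Preadditive.sum_comp, ← Limits.comp_zero (f := d), ← h2, Preadditive.comp_sum]
      refine Finset.sum_congr rfl fun S hS => ?_
      rw [Preadditive.zsmul_comp, Preadditive.comp_zsmul, hd S (Finset.mem_powerset.1 hS)]
    rw [sub_eq_zero]
    ext z
    obtain ⟨y, hy⟩ := hd' _ (ConcreteCategory.congr_hom h3 z)
    have h5 := ConcreteCategory.congr_hom hφa y
    rw [ConcreteCategory.comp_apply, hy] at h5
    exact h5.symm

end groupHomology

/-! ### Polynomiality of homology with trivial coefficients -/

/-- The alternating sum of a function over the subsets of a finite set. -/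
def alternatingSum {ι V : Type*} [AddCommGroup V] (f : Finset ι → V) (T : Finset ι) : V :=
  ∑ S ∈ T.powerset, (-1 : ℤ) ^ S.card • f S

theorem map_alternatingSum {ι V W : Type*} [AddCommGroup V] [AddCommGroup W] (φ : V →+ W)
    (f : Finset ι → V) (T : Finset ι) :
    φ (alternatingSum f T) = alternatingSum (fun S => φ (f S)) T := by
  simp [alternatingSum]

theorem alternatingSum_congr {ι V : Type*} [AddCommGroup V] {f g : Finset ι → V} {T : Finset ι}
    (h : ∀ S ⊆ T, f S = g S) : alternatingSum f T = alternatingSum g T :=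
  Finset.sum_congr rfl fun S hS => by rw [h S (Finset.mem_powerset.1 hS)]

theorem alternatingSum_sdiff {ι V : Type*} [AddCommGroup V] [DecidableEq ι] (f : Finset ι → V)
    (T : Finset ι) :
    alternatingSum (fun S => f (T \ S)) T = (-1 : ℤ) ^ T.card • alternatingSum f T := by
  rw [alternatingSum, alternatingSum, Finset.smul_sum]
  refine Finset.sum_nbij' (T \ ·) (T \ ·) ?_ ?_ ?_ ?_ ?_
  · exact fun S _ => Finset.mem_powerset.2 Finset.sdiff_subset
  · exact fun S _ => Finset.mem_powerset.2 Finset.sdiff_subset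
  · exact fun S hS => Finset.sdiff_sdiff_eq_self (Finset.mem_powerset.1 hS)
  · exact fun S hS => Finset.sdiff_sdiff_eq_self (Finset.mem_powerset.1 hS)
  · intro S hS
    rw [smul_smul, ← pow_add]
    congr 1
    have h := Finset.card_sdiff_add_card_eq_card (Finset.mem_powerset.1 hS)
    rw [← h, show (T \ S).card + S.card + (T \ S).card = 2 * (T \ S).card + S.card by ring,
      pow_add, pow_mul]
    simp

theorem alternatingSum_eq_zero_of_sdiff {ι V : Type*} [AddCommGroup V] [DecidableEq ι]
    (f : Finset ι → V) (T : Finset ι) (h : alternatingSum (fun S => f (T \ S)) T = 0) :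
    alternatingSum f T = 0 := by
  rw [alternatingSum_sdiff] at h
  have h5 := congrArg (fun v => (-1 : ℤ) ^ T.card • v) h
  simpa [smul_smul, ← mul_pow] using h5

theorem groupHomology.map_add {k G H : Type} [CommRing k] [Group G] [Group H] {A : Rep.{0} k G}
    {B : Rep.{0} k H} (f : G →* H) (φ ψ : A ⟶ Rep.res f B) (n : ℕ) :
    groupHomology.map f (φ + ψ) n = groupHomology.map f φ n + groupHomology.map f ψ n := by
  have h : groupHomology.chainsMap f (φ + ψ) =
      groupHomology.chainsMap f φ + groupHomology.chainsMap f ψ := by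
    ext i x a : 4
    simp only [ModuleCat.hom_comp, ModuleCat.hom_ofHom, LinearMap.comp_apply,
      Finsupp.lsingle_apply, HomologicalComplex.add_f_apply, ModuleCat.hom_add,
      LinearMap.add_apply]
    exact (chainsMap_f_single f (φ + ψ) i x a).trans ((Finsupp.single_add _ _ _).trans
      (congrArg₂ (· + ·) (chainsMap_f_single f φ i x a) (chainsMap_f_single f ψ i x a)).symm)
  exact (congrArg (fun c => HomologicalComplex.homologyMap c n) h).trans
    (HomologicalComplex.homologyMap_add _ _ _)

namespace TrivHomology

theorem map_add_coeff {G G' A A' : Type} [Group G] [Group G'] [AddCommGroup A] [AddCommGroup A']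
    (f : G →* G') (a b : A →+ A') (t : ℕ) : map f (a + b) t = map f a t + map f b t := by
  let r : (A →+ A') → (Rep.trivial ℤ G A ⟶ Rep.res f (Rep.trivial ℤ G' A')) := fun c =>
    Rep.ofHom ⟨c.toIntLinearMap, fun _ => rfl⟩
  have h := groupHomology.map_add f (r a) (r b) t
  ext x
  exact ConcreteCategory.congr_hom h x

variable {ι K K' : Type} [CommGroup K] [CommGroup K']

theorem alternatingSum_map_complEnd (p : ι → K →* K) (hp : ∀ i g, p i (p i g) = p i g)
    (hp' : ∀ i j, i ≠ j → ∀ g, p i (p j g) = 1) (t : ℕ) (T : Finset ι) (hT : t < T.card)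
    (A : Type) [AddCommGroup A] :
    alternatingSum (fun S => map (groupHomology.complEnd p S) (AddMonoidHom.id A) t) T = 0 := by
  have h := groupHomology.sum_neg_one_pow_smul_map_complEnd hp hp' t T hT (Rep.trivial ℤ K A)
    (fun _ _ _ => rfl) (fun S => Rep.ofHom ⟨(AddMonoidHom.id A).toIntLinearMap, fun _ => rfl⟩)
    (fun _ _ _ => rfl)
  let φ : (groupHomology (Rep.trivial ℤ K A) t ⟶ groupHomology (Rep.trivial ℤ K A) t) →+
      (TrivHomology K A t →+ TrivHomology K A t) :=
    AddMonoidHom.mk' (fun f => f.hom.toAddMonoidHom) fun _ _ => rfl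
  exact (map_alternatingSum φ _ T).symm.trans ((congrArg φ h).trans (map_zero φ))

/-- The homology of abelian groups with trivial coefficients in degree `t` is a polynomial functor
of degree at most `t`. -/
theorem isPolyMap_map (A : Type) [AddCommGroup A] (t : ℕ) :
    IsPolyMap t fun f : Additive (K →* K') => map f.toMul (AddMonoidHom.id A) t := by
  classical
  intro ι u T hT
  -- The universal case: the idempotents are the coordinate projections of a power of K', and the
  -- given homomorphisms are the coordinates of a single map v into it.
  let p : ι → (ι → K') →* (ι → K') := fun i =>
    (MonoidHom.mulSingle (fun _ => K') i).comp (Pi.evalMonoidHom (fun _ => K') i)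
  have h := alternatingSum_map_complEnd p (fun i g => by simp [p])
    (fun i j hij g => by simp [p, hij]) t T hT A
  let v : K →* (ι → K') := MonoidHom.pi fun i => (u i).toMul
  let m : (ι → K') →* K' := ∏ i ∈ T, Pi.evalMonoidHom (fun _ => K') i
  -- Removing the coordinates in S and multiplying those in T leaves the sum of the u i over T \ S.
  -- Hence the deviation appears over complements, which changes it only by a sign.
  have hm : ∀ S ⊆ T, (m.comp (groupHomology.complEnd p S)).comp v =
      (∑ i ∈ T \ S, u i).toMul := by
    intro S hS
    ext x
    rw [toMul_sum, MonoidHom.finsetProd_apply]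
    simp only [MonoidHom.comp_apply, m, MonoidHom.finsetProd_apply, Pi.evalMonoidHom_apply,
      groupHomology.complEnd_apply, Pi.div_apply, Finset.prod_apply]
    rw [← Finset.prod_sdiff hS]
    rw [Finset.prod_congr rfl (g := fun i => (u i).toMul x), Finset.prod_eq_one (s := S), mul_one]
    · intro i hi
      rw [Finset.prod_eq_single i]
      · simp [p]
      · intro j _ hij
        simp [p, hij.symm]
      · exact fun h => absurd hi h
    · intro i hi
      rw [Finset.prod_eq_one]
      · rw [div_one]
        rfl
      · intro j hj
        have hij : i ≠ j := by
          rintro rfl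
          exact (Finset.mem_sdiff.1 hi).2 hj
        simp [p, hij]
  have h3 : ∀ S ⊆ T, ((map m (AddMonoidHom.id A) t).comp (map (groupHomology.complEnd p S)
      (AddMonoidHom.id A) t)).comp (map v (AddMonoidHom.id A) t) =
      map (∑ i ∈ T \ S, u i).toMul (AddMonoidHom.id A) t := by
    intro S hS
    rw [← hm S hS, ← map_comp, ← map_comp]
    rfl
  let φ : (TrivHomology (ι → K') A t →+ TrivHomology (ι → K') A t) →+
      (TrivHomology K A t →+ TrivHomology K' A t) :=
    AddMonoidHom.mk' (fun f => ((map m (AddMonoidHom.id A) t).comp f).comp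
      (map v (AddMonoidHom.id A) t)) fun f g => by ext x; simp
  have h4 := (map_alternatingSum φ _ T).symm.trans ((congrArg φ h).trans (map_zero φ))
  replace h4 := (alternatingSum_congr h3).symm.trans h4
  exact alternatingSum_eq_zero_of_sdiff
    (fun S => map (∑ i ∈ S, u i).toMul (AddMonoidHom.id A) t) T h4

/-- Homology with trivial coefficients is polynomial in the group and additive in the
coefficients. -/
theorem isPolyMap {U A A' : Type} [AddCommGroup U] [AddCommGroup A] [AddCommGroup A'] {m n : ℕ}
    {f : U → K →* K'} (hf : IsPolyMap m fun x => Additive.ofMul (f x)) {a : U → A →+ A'}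
    (ha : IsPolyMap n a) (t : ℕ) : IsPolyMap (t * m + n) fun x => map (f x) (a x) t := by
  let coeff : (A →+ A') →+ (TrivHomology K A t →+ TrivHomology K A' t) :=
    AddMonoidHom.mk' (fun b => map (MonoidHom.id K) b t) fun b c => map_add_coeff _ b c t
  -- The map on homology is the change of coefficients followed by the change of groups, and
  -- composition is bilinear.
  have h := ((isPolyMap_map A' t).comp hf).bilin (ha.map coeff) AddMonoidHom.compHom
  convert h using 2 with x
  exact map_comp (MonoidHom.id K) (f x) (a x) (AddMonoidHom.id A') t

end TrivHomology

/-! ### Commutators and lower central series under varying homomorphisms -/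

section NilpotentGroups

open scoped commutatorElement IsMulCommutative

section CommutatorPairing

open Subgroup

variable {E : Type*} [Group E]

theorem commutatorElement_mul_right_of_mem_center {a c : E} (b : E) (h : ⁅a, c⁆ ∈ center E) :
    ⁅a, b * c⁆ = ⁅a, b⁆ * ⁅a, c⁆ := by
  rw [commutatorElement_mul_right_eq_mul_conj, mul_assoc, mul_assoc, ← mul_assoc b,
    mem_center_iff.1 h b, mul_assoc, mul_inv_cancel, mul_one]

theorem commutatorElement_mul_left_of_mem_center (a : E) {b c : E} (h : ⁅b, c⁆ ∈ center E) :
    ⁅a * b, c⁆ = ⁅a, c⁆ * ⁅b, c⁆ := by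
  rw [commutatorElement_mul_left_eq_conj_mul, mem_center_iff.1 h a, mul_assoc, mul_assoc,
    mul_inv_cancel_left, mem_center_iff.1 h]

theorem commutatorElement_eq_of_mk_eq {a a' : E} (b : E)
    (h : (QuotientGroup.mk a : E ⧸ center E) = QuotientGroup.mk a') : ⁅a, b⁆ = ⁅a', b⁆ := by
  have hz : a'⁻¹ * a ∈ center E := QuotientGroup.eq.1 h.symm
  have h1 : ⁅a'⁻¹ * a, b⁆ = 1 :=
    commutatorElement_eq_one_iff_mul_comm.2 (mem_center_iff.1 hz b).symm
  rw [← mul_inv_cancel_left a' a, commutatorElement_mul_left_of_mem_center _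
    (h1 ▸ one_mem _), h1, mul_one]

theorem commutatorElement_mem_center {a : E}
    (ha : (QuotientGroup.mk a : E ⧸ center E) ∈ center (E ⧸ center E)) (b : E) :
    ⁅a, b⁆ ∈ center E := by
  rw [← QuotientGroup.eq_one_iff, ← QuotientGroup.mk'_apply, map_commutatorElement,
    commutatorElement_eq_one_iff_mul_comm]
  exact (mem_center_iff.1 ha _).symm

/-- If a is central modulo the centre, then ⁅a, -⁆ is a homomorphism to the centre; it kills the
centre and all commutators, so it factors through the abelianization of E ⧸ center E. It is also
multiplicative in a. The pairing is what makes commutators bilinear at each stage of the lower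
central series. -/
theorem exists_commutatorPairing (E : Type*) [Group E] :
    ∃ β : Additive (center (E ⧸ center E)) →+ Additive (Abelianization (E ⧸ center E)) →+
      Additive (center E), ∀ (a b : E) (ha : QuotientGroup.mk a ∈ center (E ⧸ center E)),
      ((β (Additive.ofMul ⟨QuotientGroup.mk a, ha⟩)
        (Additive.ofMul (Abelianization.of (QuotientGroup.mk b)))).toMul : E) = ⁅a, b⁆ := by
  have hout : ∀ a : center (E ⧸ center E), QuotientGroup.mk (Quotient.out a.1) = a.1 :=
    fun a => Quotient.out_eq a.1
  have hcen : ∀ (a : center (E ⧸ center E)) (b : E), ⁅Quotient.out a.1, b⁆ ∈ center E :=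
    fun a b => commutatorElement_mem_center ((hout a).symm ▸ a.2) b
  let κ : center (E ⧸ center E) → E →* center E := fun a =>
    MonoidHom.mk' (fun b => ⟨⁅Quotient.out a.1, b⁆, hcen a b⟩)
      fun b c => Subtype.ext (commutatorElement_mul_right_of_mem_center b (hcen a c))
  have hκ : ∀ a, ∀ z ∈ center E, κ a z = 1 := fun a z hz => Subtype.ext
    (commutatorElement_eq_one_iff_mul_comm.2 (mem_center_iff.1 hz _))
  let μ : center (E ⧸ center E) → Abelianization (E ⧸ center E) →* center E := fun a =>
    Abelianization.lift (QuotientGroup.lift (center E) (κ a) (hκ a))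
  have hμ : ∀ a b, μ a (Abelianization.of (QuotientGroup.mk b)) = κ a b := fun a b => rfl
  let ν : center (E ⧸ center E) →* Abelianization (E ⧸ center E) →* center E :=
    MonoidHom.mk' μ fun a a' => by
      ext b
      change ⁅Quotient.out (a * a').1, b⁆ = ⁅Quotient.out a.1, b⁆ * ⁅Quotient.out a'.1, b⁆
      rw [← commutatorElement_mul_left_of_mem_center _ (hcen a' b)]
      apply commutatorElement_eq_of_mk_eq
      rw [hout, QuotientGroup.mk_mul, hout, hout]
      rfl
  refine ⟨AddMonoidHom.mk' (fun a => MonoidHom.toAdditive (ν a.toMul)) fun a a' => ?_,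
    fun a b ha => ?_⟩
  · exact AddMonoidHom.ext fun x => congrArg Additive.ofMul
      (DFunLike.congr_fun (map_mul ν a.toMul a'.toMul) x.toMul)
  · change ⁅Quotient.out (QuotientGroup.mk a : E ⧸ center E), b⁆ = ⁅a, b⁆
    exact commutatorElement_eq_of_mk_eq b (hout ⟨_, ha⟩)

end CommutatorPairing

section CentralPoly

open Subgroup

variable {U : Type*} [AddCommGroup U] {E E' : Type*} [Group E] [Group E']

/-- A map from an abelian group to a group is central polynomial of degree at most `n` if it is
polynomial of degree at most `n` as a map to the center. -/
def IsCentralPolyMap (n : ℕ) (f : U → E') : Prop :=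
  ∃ F : U → Additive (center E'), IsPolyMap n F ∧ ∀ h, ((F h).toMul : E') = f h

theorem IsCentralPolyMap.mul {n : ℕ} {f g : U → E'} (hf : IsCentralPolyMap n f)
    (hg : IsCentralPolyMap n g) : IsCentralPolyMap n fun h => f h * g h := by
  obtain ⟨F, hF, hF'⟩ := hf
  obtain ⟨G, hG, hG'⟩ := hg
  exact ⟨fun h => F h + G h, hF.add hG, fun h => by simp [hF', hG']⟩

theorem IsCentralPolyMap.inv {n : ℕ} {f : U → E'} (hf : IsCentralPolyMap n f) :
    IsCentralPolyMap n fun h => (f h)⁻¹ := by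
  obtain ⟨F, hF, hF'⟩ := hf
  exact ⟨fun h => - F h, hF.neg, fun h => by simp [hF']⟩

theorem IsCentralPolyMap.one (n : ℕ) : IsCentralPolyMap n fun _ : U => (1 : E') :=
  ⟨fun _ => 0, IsPolyMap.zero, fun _ => rfl⟩

/-- The elements on which a family of homomorphisms depends in a central polynomial way. -/
def centralPolySubgroup (n : ℕ) (φ : U → E →* E') : Subgroup E where
  carrier := {y | IsCentralPolyMap n fun h => φ h y}
  mul_mem' hx hy := by simpa using hx.mul hy
  one_mem' := by simpa using IsCentralPolyMap.one n
  inv_mem' hx := by simpa using hx.inv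

/-- The commutator is the pairing applied to a map of degree n and an additive map. -/
theorem IsCentralPolyMap.commutatorElement {n : ℕ} {f g : U → E'}
    (hf : IsCentralPolyMap n fun h => (QuotientGroup.mk (f h) : E' ⧸ center E'))
    (hg : ∀ h h', Abelianization.of (QuotientGroup.mk (g (h + h')) : E' ⧸ center E') =
      Abelianization.of (QuotientGroup.mk (g h)) * Abelianization.of (QuotientGroup.mk (g h'))) :
    IsCentralPolyMap (n + 1) fun h => ⁅f h, g h⁆ := by
  obtain ⟨β, hβ⟩ := exists_commutatorPairing E'
  obtain ⟨F, hF, hF'⟩ := hf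
  let G : U →+ Additive (Abelianization (E' ⧸ center E')) :=
    AddMonoidHom.mk' (fun h => Additive.ofMul (Abelianization.of (QuotientGroup.mk (g h)))) hg
  refine ⟨_, hF.bilin (IsPolyMap.of_hom G) β, fun h => ?_⟩
  have h1 : (QuotientGroup.mk (f h) : E' ⧸ center E') ∈ center (E' ⧸ center E') :=
    by
    simpa only [hF'] using (F h).toMul.2
  refine Eq.trans ?_ (hβ (f h) (g h) h1)
  have h2 : F h = Additive.ofMul ⟨_, h1⟩ :=
    Additive.toMul.injective (Subtype.ext (hF' h))
  rw [h2]
  rfl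

theorem commutator_le_centralPolySubgroup {n : ℕ} (φ : U → E →* E')
    (hφ : ∀ x h h', Abelianization.of (QuotientGroup.mk (φ (h + h') x) : E' ⧸ center E') =
      Abelianization.of (QuotientGroup.mk (φ h x)) * Abelianization.of (QuotientGroup.mk (φ h' x)))
    {S : Subgroup E}
    (hS : S ≤ centralPolySubgroup n fun h => (QuotientGroup.mk' (center E')).comp (φ h)) :
    ⁅S, (⊤ : Subgroup E)⁆ ≤ centralPolySubgroup (n + 1) φ := by
  rw [Subgroup.commutator_le]
  intro a ha b _
  have h := IsCentralPolyMap.commutatorElement (f := fun h => φ h a) (g := fun h => φ h b)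
    (hS ha) (hφ b)
  change IsCentralPolyMap _ fun h => φ h ⁅a, b⁆
  simpa only [map_commutatorElement] using h

theorem lowerCentralSeries_quotient_center_eq_bot {k : ℕ}
    (h : (⊤ : Subgroup E').lowerCentralSeries (k + 1) = ⊥) :
    (⊤ : Subgroup (E' ⧸ center E')).lowerCentralSeries k = ⊥ := by
  have h1 : (⊤ : Subgroup E').lowerCentralSeries k ≤ center E' :=
    commutator_top_right_eq_bot_iff_le_center.1 h
  have h2 := Subgroup.map_lowerCentralSeries (⊤ : Subgroup E') (QuotientGroup.mk' (center E')) k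
  rw [← MonoidHom.range_eq_map, QuotientGroup.range_mk'] at h2
  rw [← h2, Subgroup.map_eq_bot_iff, QuotientGroup.ker_mk']
  exact h1

/-- Induction on the class through E' ⧸ center E'. In the abelian case the family is additive, of
degree 1, and each further commutator raises the degree by one. -/
theorem lowerCentralSeries_le_centralPolySubgroup (k : ℕ) {E' : Type*} [Group E']
    (hE' : (⊤ : Subgroup E').lowerCentralSeries (k + 1) = ⊥) (φ : U → E →* E')
    (hφ : ∀ x h h', Abelianization.of (φ (h + h') x) =
      Abelianization.of (φ h x) * Abelianization.of (φ h' x)) :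
    (⊤ : Subgroup E).lowerCentralSeries k ≤ centralPolySubgroup (k + 1) φ := by
  induction k generalizing E' with
  | zero =>
    intro y _
    have h1 : center E' = ⊤ := by
      rw [Subgroup.top_lowerCentralSeries_one] at hE'
      exact (commutator_eq_bot_iff_center_eq_top _).1 hE'
    have h2 : Function.Injective (Abelianization.of : E' →* Abelianization E') := by
      rw [← MonoidHom.ker_eq_bot_iff, Abelianization.ker_of,
        commutator_eq_bot_iff_center_eq_top, h1]
    let F : U →+ Additive (center E') := AddMonoidHom.mk'
      (fun h => Additive.ofMul ⟨φ h y, h1 ▸ Subgroup.mem_top _⟩)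
      fun h h' => congrArg Additive.ofMul (Subtype.ext (h2 (by simpa using hφ y h h')))
    exact ⟨F, IsPolyMap.of_hom F, fun h => rfl⟩
  | succ k ih =>
    have hφ' : ∀ x h h', Abelianization.of (QuotientGroup.mk (φ (h + h') x) : E' ⧸ center E') =
      Abelianization.of (QuotientGroup.mk (φ h x)) *
        Abelianization.of (QuotientGroup.mk (φ h' x)) := fun x h h' => by
      simpa using congrArg (Abelianization.map (QuotientGroup.mk' (center E'))) (hφ x h h')
    exact commutator_le_centralPolySubgroup φ hφ' (ih (lowerCentralSeries_quotient_center_eq_bot hE')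
      _ hφ')

/-- Only the image modulo the centre has to be additive on abelianizations, because commutators do
not see central factors. This form suits the bar extension, whose own abelianization also contains
contributions of chains. -/
theorem lowerCentralSeries_succ_le_centralPolySubgroup {k : ℕ}
    (hE' : (⊤ : Subgroup (E' ⧸ center E')).lowerCentralSeries (k + 1) = ⊥) (φ : U → E →* E')
    (hφ : ∀ x h h', Abelianization.of (QuotientGroup.mk (φ (h + h') x) : E' ⧸ center E') =
      Abelianization.of (QuotientGroup.mk (φ h x)) *
        Abelianization.of (QuotientGroup.mk (φ h' x))) :
    (⊤ : Subgroup E).lowerCentralSeries (k + 1) ≤ centralPolySubgroup (k + 2) φ :=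
  commutator_le_centralPolySubgroup φ hφ
    (lowerCentralSeries_le_centralPolySubgroup k hE' _ hφ)

end CentralPoly

section EqLocus

open Subgroup

variable {E E' : Type*} [Group E] [Group E']

theorem commutator_le_eqLocus {φ ψ : E →* E'}
    (h : ∀ x, Abelianization.of (QuotientGroup.mk (φ x) : E' ⧸ center E') =
      Abelianization.of (QuotientGroup.mk (ψ x)))
    {S : Subgroup E}
    (hS : S ≤ ((QuotientGroup.mk' (center E')).comp φ).eqLocus
        ((QuotientGroup.mk' (center E')).comp ψ) ⊓
      (center (E' ⧸ center E')).comap ((QuotientGroup.mk' (center E')).comp φ)) :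
    ⁅S, (⊤ : Subgroup E)⁆ ≤ φ.eqLocus ψ ⊓ (center E').comap φ := by
  rw [Subgroup.commutator_le]
  intro a ha b _
  obtain ⟨h1, h2⟩ := hS ha
  change (QuotientGroup.mk (φ a) : E' ⧸ center E') = QuotientGroup.mk (ψ a) at h1
  change (QuotientGroup.mk (φ a) : E' ⧸ center E') ∈ center _ at h2
  refine ⟨?_, ?_⟩
  · change φ _ = ψ _
    obtain ⟨β, hβ⟩ := exists_commutatorPairing E'
    rw [map_commutatorElement, map_commutatorElement, ← commutatorElement_eq_of_mk_eq _ h1,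
      ← hβ _ _ h2, ← hβ _ _ h2, h]
  · change φ _ ∈ center E'
    rw [map_commutatorElement]
    exact commutatorElement_mem_center h2 _

/-- The same induction as for polynomiality, now showing that the last term of the series sees only
the abelianization. Centrality of the values is carried along so that the commutator pairing
applies. -/
theorem lowerCentralSeries_le_eqLocus (k : ℕ) {E' : Type*} [Group E']
    (hE' : (⊤ : Subgroup E').lowerCentralSeries (k + 1) = ⊥) (φ ψ : E →* E')
    (h : ∀ x, Abelianization.of (φ x) = Abelianization.of (ψ x)) :
    (⊤ : Subgroup E).lowerCentralSeries k ≤ φ.eqLocus ψ ⊓ (center E').comap φ := by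
  induction k generalizing E' with
  | zero =>
    intro y _
    have h1 : center E' = ⊤ := by
      rw [Subgroup.top_lowerCentralSeries_one] at hE'
      exact (commutator_eq_bot_iff_center_eq_top _).1 hE'
    have h2 : Function.Injective (Abelianization.of : E' →* Abelianization E') := by
      rw [← MonoidHom.ker_eq_bot_iff, Abelianization.ker_of,
        commutator_eq_bot_iff_center_eq_top, h1]
    exact ⟨h2 (h y), by simp [h1]⟩
  | succ k ih =>
    have h' : ∀ x, Abelianization.of (QuotientGroup.mk (φ x) : E' ⧸ center E') =
        Abelianization.of (QuotientGroup.mk (ψ x)) := fun x => by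
      simpa using congrArg (Abelianization.map (QuotientGroup.mk' (center E'))) (h x)
    exact commutator_le_eqLocus h' (ih (lowerCentralSeries_quotient_center_eq_bot hE') _ _ h')

theorem lowerCentralSeries_succ_le_eqLocus {k : ℕ}
    (hE' : (⊤ : Subgroup (E' ⧸ center E')).lowerCentralSeries (k + 1) = ⊥) (φ ψ : E →* E')
    (h : ∀ x, Abelianization.of (QuotientGroup.mk (φ x) : E' ⧸ center E') =
      Abelianization.of (QuotientGroup.mk (ψ x))) :
    (⊤ : Subgroup E).lowerCentralSeries (k + 1) ≤ φ.eqLocus ψ ⊓ (center E').comap φ :=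
  commutator_le_eqLocus h (lowerCentralSeries_le_eqLocus k hE' _ _ h)

end EqLocus

/-! ### The bar extension: a central extension containing second homology -/

section BarExtension

open Finsupp

variable (N : Type) [Group N]

/-- The integral bar chains of degree two that are boundaries. -/
noncomputable def barBoundaries : AddSubgroup (N × N →₀ ℤ) :=
  (groupHomology.boundaries₂ (Rep.trivial ℤ N ℤ)).toAddSubgroup

/-- The integral bar chains of degree two modulo boundaries. -/
abbrev BarQuotient : Type := (N × N →₀ ℤ) ⧸ barBoundaries N

variable {N}

/-- The class of a bar symbol. -/
noncomputable def bar (g h : N) : BarQuotient N := QuotientAddGroup.mk (single (g, h) 1)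

theorem single_mem_barBoundaries (g h j : N) (a : ℤ) :
    single (h, j) a - single (g * h, j) a + single (g, h * j) a - single (g, h) a ∈
      barBoundaries N :=
  ⟨single (g, h, j) a, groupHomology.d₃₂_single (A := Rep.trivial ℤ N ℤ) (g, h, j) a⟩

theorem bar_mul_left (g h j : N) : bar g h + bar (g * h) j = bar h j + bar g (h * j) := by
  have h1 := (QuotientAddGroup.eq_zero_iff _).2 (single_mem_barBoundaries g h j 1)
  rw [QuotientAddGroup.mk_sub, QuotientAddGroup.mk_add, QuotientAddGroup.mk_sub] at h1
  change bar h j - bar (g * h) j + bar g (h * j) - bar g h = 0 at h1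
  rw [sub_add_eq_add_sub, sub_sub, sub_eq_zero] at h1
  rw [h1, add_comm]

theorem bar_one_left (g : N) : bar 1 g = bar (1 : N) 1 := by
  simpa using (bar_mul_left 1 1 g).symm

theorem bar_one_right (g : N) : bar g 1 = bar (1 : N) 1 := by
  simpa using bar_mul_left g 1 1

/-- The condition is the 2-cocycle identity: the bar quotient is the universal target of 2-cocycles
with trivial action. -/
theorem barBoundaries_le {V : Type*} [AddCommGroup V] (F : (N × N →₀ ℤ) →+ V)
    (h : ∀ g h j : N, F (single (g, h) 1) + F (single (g * h, j) 1) =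
      F (single (h, j) 1) + F (single (g, h * j) 1)) : barBoundaries N ≤ F.ker := by
  rintro _ ⟨y, rfl⟩
  let d : (N × N × N →₀ ℤ) →+ (N × N →₀ ℤ) :=
    (groupHomology.d₃₂ (Rep.trivial ℤ N ℤ)).hom.toAddMonoidHom
  suffices F.comp d = 0 from DFunLike.congr_fun this y
  refine Finsupp.addHom_ext' fun ⟨g, g', j⟩ => AddMonoidHom.ext_int ?_
  have h1 : d (single (g, g', j) 1) = single (g', j) 1 - single (g * g', j) 1 +
    single (g, g' * j) 1 - single (g, g') 1 :=
    groupHomology.d₃₂_single (A := Rep.trivial ℤ N ℤ) (g, g', j) 1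
  change F (d (single (g, g', j) 1)) = 0
  rw [h1, map_sub, map_add, map_sub, sub_add_eq_add_sub, ← h, add_sub_cancel_right, sub_self]

/-- The homomorphism on the quotient of the bar chains that is induced by a group
homomorphism. -/
noncomputable def BarQuotient.map {N' : Type} [Group N'] (φ : N →* N') :
    BarQuotient N →+ BarQuotient N' :=
  QuotientAddGroup.lift _ ((QuotientAddGroup.mk' _).comp
    (mapDomain.addMonoidHom (Prod.map φ φ))) (barBoundaries_le _ fun g h j => by
      simpa [bar] using bar_mul_left (φ g) (φ h) (φ j))

@[simp] theorem BarQuotient.map_bar {N' : Type} [Group N'] (φ : N →* N') (g h : N) :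
    BarQuotient.map φ (bar g h) = bar (φ g) (φ h) := by
  simp [BarQuotient.map, bar]

theorem BarQuotient.hom_ext {V : Type*} [AddCommGroup V] {F G : BarQuotient N →+ V}
    (h : ∀ g h, F (bar g h) = G (bar g h)) : F = G :=
  QuotientAddGroup.addMonoidHom_ext _ (Finsupp.addHom_ext' fun ⟨g, j⟩ =>
    AddMonoidHom.ext_int (h g j))

variable (N) in
/-- The central extension of a group by the quotient of the bar chains of degree two by the
boundaries that is defined by the tautological cocycle. -/
@[ext] structure BarExtension : Type where
  chain : BarQuotient N
  base : N

namespace BarExtension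

noncomputable instance : Mul (BarExtension N) :=
  ⟨fun x y => ⟨x.chain + y.chain + bar x.base y.base, x.base * y.base⟩⟩

/-- The cocycle is not normalized, so the unit carries the correction -bar 1 1. The same correction
enters `incl`. -/
noncomputable instance : One (BarExtension N) := ⟨⟨-bar 1 1, 1⟩⟩

noncomputable instance : Inv (BarExtension N) :=
  ⟨fun x => ⟨-x.chain - bar x.base⁻¹ x.base - bar 1 1, x.base⁻¹⟩⟩

@[simp] theorem chain_mul (x y : BarExtension N) :
    (x * y).chain = x.chain + y.chain + bar x.base y.base := rfl

@[simp] theorem base_mul (x y : BarExtension N) : (x * y).base = x.base * y.base := rfl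

@[simp] theorem chain_one : (1 : BarExtension N).chain = -bar 1 1 := rfl

@[simp] theorem base_one : (1 : BarExtension N).base = 1 := rfl

noncomputable instance : Group (BarExtension N) :=
  Group.ofLeftAxioms
    (fun x y z => BarExtension.ext (by
      calc x.chain + y.chain + bar x.base y.base + z.chain + bar (x.base * y.base) z.base
          = x.chain + y.chain + z.chain + (bar x.base y.base + bar (x.base * y.base) z.base) := by
            abel
        _ = x.chain + y.chain + z.chain + (bar y.base z.base + bar x.base (y.base * z.base)) := by
            rw [bar_mul_left]
        _ = x.chain + (y.chain + z.chain + bar y.base z.base) + bar x.base (y.base * z.base) := by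
            abel) (mul_assoc _ _ _))
    (fun x => BarExtension.ext (by simp [bar_one_left]) (one_mul _))
    (fun x => BarExtension.ext (by
      change -x.chain - bar x.base⁻¹ x.base - bar 1 1 + x.chain + bar x.base⁻¹ x.base = - bar 1 1
      abel) (inv_mul_cancel _))

variable (N) in
/-- The projection of the extension. -/
def toBase : BarExtension N →* N where
  toFun := base
  map_one' := rfl
  map_mul' _ _ := rfl

theorem chain_mk_mem_center (a : BarQuotient N) :
    (⟨a - bar 1 1, 1⟩ : BarExtension N) ∈ Subgroup.center (BarExtension N) :=
  Subgroup.mem_center_iff.2 fun x => BarExtension.ext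
    (by simp [bar_one_left, bar_one_right, add_comm]) (by simp)

/-- The inclusion of the kernel of the extension. -/
noncomputable def incl : BarQuotient N →+ Additive (Subgroup.center (BarExtension N)) :=
  AddMonoidHom.mk' (fun a => Additive.ofMul ⟨⟨a - bar 1 1, 1⟩, chain_mk_mem_center a⟩) fun a b =>
    congrArg Additive.ofMul (Subtype.ext (BarExtension.ext (by
      change a + b - bar 1 1 = (a - bar 1 1) + (b - bar 1 1) + bar 1 1
      abel) (one_mul 1).symm))

theorem coe_incl (a : BarQuotient N) :
    ((incl a).toMul : BarExtension N) = ⟨a - bar 1 1, 1⟩ := rfl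

theorem incl_injective : Function.Injective (incl : BarQuotient N →+ _) := fun _ _ h =>
  sub_left_injective (congrArg BarExtension.chain
    (congrArg (fun z => ((Additive.toMul z : Subgroup.center (BarExtension N)) : BarExtension N)) h))

theorem eq_incl_mul (x : BarExtension N) : x = (incl x.chain).toMul * ⟨0, x.base⟩ :=
  BarExtension.ext (by simp [coe_incl, bar_one_left]) (by simp [coe_incl])

theorem mem_center_of_base_eq_one {x : BarExtension N} (hx : x.base = 1) :
    x ∈ Subgroup.center (BarExtension N) := by
  have h : x = ⟨x.chain + bar 1 1 - bar 1 1, 1⟩ := BarExtension.ext (by simp) hx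
  exact h ▸ chain_mk_mem_center _

theorem mk_mul_mk (g h : N) : (⟨0, g⟩ * ⟨0, h⟩ : BarExtension N) =
    (incl (bar g h)).toMul * ⟨0, g * h⟩ :=
  (eq_incl_mul _).trans (by simp)

/-- The functoriality of the extension. -/
noncomputable def map {N' : Type} [Group N'] (φ : N →* N') : BarExtension N →* BarExtension N' where
  toFun x := ⟨BarQuotient.map φ x.chain, φ x.base⟩
  map_one' := BarExtension.ext (by simp) (by simp)
  map_mul' x y := BarExtension.ext (by simp) (by simp)

@[simp] theorem base_map {N' : Type} [Group N'] (φ : N →* N') (x : BarExtension N) :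
    (map φ x).base = φ x.base := rfl

theorem map_incl {N' : Type} [Group N'] (φ : N →* N') (a : BarQuotient N) :
    map φ (incl a).toMul = (incl (BarQuotient.map φ a)).toMul :=
  BarExtension.ext (by simp [coe_incl, map]) (by simp [coe_incl])

variable (N) in
/-- The differential on the quotient of the bar chains of degree two. -/
noncomputable def barDiff : BarQuotient N →+ (N →₀ ℤ) :=
  QuotientAddGroup.lift _ (groupHomology.d₂₁ (Rep.trivial ℤ N ℤ)).hom.toAddMonoidHom (by
    rintro _ ⟨y, rfl⟩
    exact congr($(groupHomology.d₃₂_comp_d₂₁ (Rep.trivial ℤ N ℤ)) y))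

@[simp] theorem barDiff_bar (g h : N) :
    barDiff N (bar g h) = single h 1 - single (g * h) 1 + single g 1 :=
  groupHomology.d₂₁_single (A := Rep.trivial ℤ N ℤ) (g, h) 1

/-- An element of the kernel of the differential lies in the commutator subgroup of the
extension. -/
theorem incl_mem_commutator {a : BarQuotient N} (ha : barDiff N a = 0) :
    ((incl a).toMul : BarExtension N) ∈ commutator (BarExtension N) := by
  let Ψ : (N →₀ ℤ) →+ Additive (Abelianization (BarExtension N)) :=
    Finsupp.liftAddHom fun g => (zmultiplesHom _) (Additive.ofMul (Abelianization.of ⟨0, g⟩))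
  have hΨ : ∀ g : N, Ψ (single g 1) = Additive.ofMul (Abelianization.of ⟨0, g⟩) := fun g => by
    simp [Ψ]
  let χ : BarQuotient N →+ Additive (Abelianization (BarExtension N)) :=
    (MonoidHom.toAdditive (Abelianization.of.comp (Subgroup.center _).subtype)).comp incl
  -- In the abelianization, (0, g)(0, h) = bar(g, h) · (0, gh) says that the class of bar(g, h) is
  -- [g] + [h] - [gh], the image of its differential.
  have h : Ψ.comp (barDiff N) = χ := BarQuotient.hom_ext fun g h => by
    have h1 := congrArg (fun x => Additive.ofMul (Abelianization.of x)) (mk_mul_mk g h)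
    simp only [map_mul, ofMul_mul] at h1
    change _ = χ (bar g h) + _ at h1
    rw [AddMonoidHom.comp_apply, barDiff_bar, map_add, map_sub, hΨ, hΨ, hΨ, sub_add_eq_add_sub,
      add_comm, h1, add_sub_cancel_right]
  have h2 : χ a = 0 := by rw [← h, AddMonoidHom.comp_apply, ha, map_zero]
  rw [← Abelianization.ker_of]
  exact congrArg Additive.toMul h2

end BarExtension
end BarExtension

/-! ### Second homology inside the bar quotient -/

section SecondHomology

open groupHomology

/-- The natural embedding of the second integral homology into the bar chains of degree two modulo
boundaries. -/
theorem exists_homologyToBarQuotient (N : Type) [Group N] :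
    ∃ j : IntHomology N 2 →+ BarQuotient N, ∀ z : cycles₂ (Rep.trivial ℤ N ℤ),
      j (H2π (Rep.trivial ℤ N ℤ) z) = QuotientAddGroup.mk z.1 := by
  let π : cycles₂ (Rep.trivial ℤ N ℤ) →+ IntHomology N 2 :=
    (H2π (Rep.trivial ℤ N ℤ)).hom.toAddMonoidHom
  have hπ : Function.Surjective π := fun x => H2_induction_on x fun z => ⟨z, rfl⟩
  let q : cycles₂ (Rep.trivial ℤ N ℤ) →+ BarQuotient N :=
    (QuotientAddGroup.mk' (barBoundaries N)).comp
      (cycles₂ (Rep.trivial ℤ N ℤ)).subtype.toAddMonoidHom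
  have hq : π.ker ≤ q.ker := fun z hz =>
    (QuotientAddGroup.eq_zero_iff _).2 ((H2π_eq_zero_iff z).1 hz)
  exact ⟨π.liftOfSurjective hπ ⟨q, hq⟩, fun z =>
    AddMonoidHom.liftOfRightInverse_comp_apply π _ _ ⟨q, hq⟩ z⟩

/-- The natural embedding of the second integral homology into the bar chains of degree two modulo
boundaries. -/
noncomputable def homologyToBarQuotient (N : Type) [Group N] : IntHomology N 2 →+ BarQuotient N :=
  (exists_homologyToBarQuotient N).choose

theorem homologyToBarQuotient_H2π {N : Type} [Group N] (z : cycles₂ (Rep.trivial ℤ N ℤ)) :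
    homologyToBarQuotient N (H2π (Rep.trivial ℤ N ℤ) z) = QuotientAddGroup.mk z.1 :=
  (exists_homologyToBarQuotient N).choose_spec z

theorem homologyToBarQuotient_injective (N : Type) [Group N] :
    Function.Injective (homologyToBarQuotient N) := by
  rw [injective_iff_map_eq_zero]
  intro x
  induction x using H2_induction_on with | h z => ?_
  intro h
  rw [homologyToBarQuotient_H2π] at h
  exact (H2π_eq_zero_iff z).2 ((QuotientAddGroup.eq_zero_iff _).1 h)

theorem homologyToBarQuotient_map {N N' : Type} [Group N] [Group N'] (φ : N →* N')
    (x : IntHomology N 2) : homologyToBarQuotient N' (IntHomology.map φ 2 x) =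
      BarQuotient.map φ (homologyToBarQuotient N x) := by
  induction x using H2_induction_on with | h z => ?_
  have h1 := H2π_comp_map_apply (A := Rep.trivial ℤ N ℤ) (B := Rep.trivial ℤ N' ℤ) φ
    (Rep.ofHom ⟨(AddMonoidHom.id ℤ).toIntLinearMap, fun _ => rfl⟩) z
  refine (congrArg (homologyToBarQuotient N') h1).trans ?_
  rw [homologyToBarQuotient_H2π, homologyToBarQuotient_H2π, coe_mapCycles₂]
  refine congrArg QuotientAddGroup.mk ?_
  generalize z.1 = y
  have h2 : (chainsMap₂ (A := Rep.trivial ℤ N ℤ) (B := Rep.trivial ℤ N' ℤ) φ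
      (Rep.ofHom ⟨(AddMonoidHom.id ℤ).toIntLinearMap, fun _ => rfl⟩)).hom.toAddMonoidHom =
      Finsupp.mapDomain.addMonoidHom (M := ℤ) (Prod.map φ φ) := by
    refine Finsupp.addHom_ext' fun g => AddMonoidHom.ext_int ?_
    change chainsMap₂ _ _ (Finsupp.single g 1) = Finsupp.mapDomain _ (Finsupp.single g 1)
    refine (congrArg (Finsupp.mapRange.linearMap (AddMonoidHom.id ℤ).toIntLinearMap)
      Finsupp.mapDomain_single).trans ?_
    rw [Finsupp.mapDomain_single, Finsupp.mapRange.linearMap_apply, Finsupp.mapRange_single]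
    rfl
  exact DFunLike.congr_fun h2 y

theorem barDiff_homologyToBarQuotient {N : Type} [Group N] (x : IntHomology N 2) :
    BarExtension.barDiff N (homologyToBarQuotient N x) = 0 := by
  induction x using H2_induction_on with | h z => ?_
  rw [homologyToBarQuotient_H2π]
  exact z.2

end SecondHomology

/-- Central factors drop out of commutators, so the image of f already produces all of them. -/
theorem commutator_le_map_commutator {F E : Type*} [Group F] [Group E] (f : F →* E)
    (hf : ∀ x, ∃ w, ∃ z ∈ Subgroup.center E, x = f w * z) :
    commutator E ≤ (commutator F).map f := by
  rw [commutator_def, Subgroup.commutator_le]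
  intro x _ y _
  obtain ⟨w, z, hz, rfl⟩ := hf x
  obtain ⟨w', z', hz', rfl⟩ := hf y
  refine ⟨⁅w, w'⁆, Subgroup.commutator_mem_commutator trivial trivial, ?_⟩
  have h1 : ∀ a : E, ⁅a, z'⁆ = 1 := fun a =>
    commutatorElement_eq_one_iff_mul_comm.2 (Subgroup.mem_center_iff.1 hz' a)
  have h2 : ∀ a : E, ⁅z, a⁆ = 1 := fun a =>
    commutatorElement_eq_one_iff_mul_comm.2 (Subgroup.mem_center_iff.1 hz a).symm
  rw [commutatorElement_mul_right_of_mem_center _ (by rw [h1]; exact one_mem _), h1, mul_one,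
    commutatorElement_mul_left_of_mem_center _ (by rw [h2]; exact one_mem _), h2, mul_one,
    map_commutatorElement]

theorem Subgroup.map_top_lowerCentralSeries_le {G H : Type*} [Group G] [Group H] (f : G →* H)
    (n : ℕ) : ((⊤ : Subgroup G).lowerCentralSeries n).map f ≤
      (⊤ : Subgroup H).lowerCentralSeries n := by
  induction n with
  | zero => exact le_top
  | succ n ih =>
    exact (Subgroup.map_commutator _ _ f).le.trans (Subgroup.commutator_mono ih le_top)

namespace FreeNilpotent

variable {c r s : ℕ}

/-- As in Hopf's formula: a 2-cycle lies in the commutator subgroup of the extension, hence is the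
image of some w in the free group. It lies over 1 in N, so w belongs to Γ_{c+1} of the free group,
and its image to Γ_{c+1} of the extension. -/
theorem incl_homologyToBarQuotient_mem (x : IntHomology (FreeNilpotent c r) 2) :
    ((BarExtension.incl (homologyToBarQuotient _ x)).toMul : BarExtension (FreeNilpotent c r)) ∈
      (⊤ : Subgroup (BarExtension (FreeNilpotent c r))).lowerCentralSeries c := by
  let f : FreeGroup (Fin r) →* BarExtension (FreeNilpotent c r) :=
    FreeGroup.lift fun i => ⟨0, gen i⟩
  have hf : ∀ w, (f w).base = QuotientGroup.mk w := fun w => by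
    have h : (BarExtension.toBase _).comp f =
        QuotientGroup.mk' ((⊤ : Subgroup (FreeGroup (Fin r))).lowerCentralSeries c) :=
      FreeGroup.ext_hom _ _ fun i => by simp [f, BarExtension.toBase, gen]
    exact DFunLike.congr_fun h w
  obtain ⟨w, hw, hwx⟩ := commutator_le_map_commutator f (fun x => by
    obtain ⟨w, hw⟩ := QuotientGroup.mk_surjective x.base
    refine ⟨w, (f w)⁻¹ * x, BarExtension.mem_center_of_base_eq_one ?_, by simp⟩
    change (BarExtension.toBase (FreeNilpotent c r)) ((f w)⁻¹ * x) = 1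
    rw [map_mul, map_inv, inv_mul_eq_one]
    exact (hf w).trans hw) (BarExtension.incl_mem_commutator (barDiff_homologyToBarQuotient x))
  have h1 : (QuotientGroup.mk w : FreeNilpotent c r) = 1 := by
    rw [← hf, hwx]
    rfl
  rw [← hwx]
  exact Subgroup.map_top_lowerCentralSeries_le f c
    (Subgroup.mem_map_of_mem f ((QuotientGroup.eq_one_iff _).1 h1))

end FreeNilpotent

/-! ### First homology -/

section FirstHomology

open groupHomology

/-- The class of a group element in the first integral homology. -/
noncomputable def homologyClass (N : Type) [Group N] : N →* Multiplicative (IntHomology N 1) :=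
  MonoidHom.mk' (fun g => Multiplicative.ofAdd (mkH1OfIsTrivial (Rep.trivial ℤ N ℤ)
    (Additive.ofMul (Abelianization.of g)) (1 : ℤ))) fun g h => by
      rw [map_mul, ofMul_mul, _root_.map_add]
      rfl

theorem intHomology_one_hom_ext {N V : Type} [Group N] [AddCommGroup V]
    {F G : IntHomology N 1 →+ V}
    (h : ∀ g, F (homologyClass N g).toAdd = G (homologyClass N g).toAdd) : F = G := by
  let π : (N →₀ ℤ) →+ IntHomology N 1 := (H1π (Rep.trivial ℤ N ℤ)).hom.toAddMonoidHom.comp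
    (cycles₁IsoOfIsTrivial (Rep.trivial ℤ N ℤ)).inv.hom.toAddMonoidHom
  have h1 : F.comp π = G.comp π := Finsupp.addHom_ext' fun g => AddMonoidHom.ext_int (h g)
  ext x
  induction x using H1_induction_on with | h z => ?_
  exact DFunLike.congr_fun h1 z.1

theorem map_homologyClass {N N' : Type} [Group N] [Group N'] (φ : N →* N') (g : N) :
    IntHomology.map φ 1 (homologyClass N g).toAdd = (homologyClass N' (φ g)).toAdd := by
  have h1 := H1π_comp_map_apply (A := Rep.trivial ℤ N ℤ) (B := Rep.trivial ℤ N' ℤ) φ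
    (Rep.ofHom ⟨(AddMonoidHom.id ℤ).toIntLinearMap, fun _ => rfl⟩)
    ((cycles₁IsoOfIsTrivial _).inv (Finsupp.single g (1 : ℤ)))
  refine h1.trans (congrArg (H1π (Rep.trivial ℤ N' ℤ)) (Subtype.ext ?_))
  refine (congrArg (Finsupp.mapRange.linearMap (AddMonoidHom.id ℤ).toIntLinearMap)
      Finsupp.mapDomain_single).trans ?_
  rw [Finsupp.mapRange.linearMap_apply, Finsupp.mapRange_single]
  rfl

end FirstHomology

/-! ### Homology of free nilpotent groups as a function of the abelianization -/

namespace FreeNilpotent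

variable {c r s : ℕ} (hc : 1 ≤ c)

theorem abel_surjective : Function.Surjective (abel hc : FreeNilpotent c r →* _) := by
  rw [← MonoidHom.range_eq_top, eq_top_iff]
  intro v _
  have h := Finset.univ_sum_single v.toAdd
  rw [← ofAdd_toAdd v, ← h, ofAdd_sum]
  refine Subgroup.prod_mem _ fun i _ => ⟨gen i ^ v.toAdd i, ?_⟩
  rw [map_zpow, abel_gen, ← ofAdd_zsmul, ← Pi.single_smul, smul_eq_mul, mul_one]

/-- A homomorphism to an abelian group depends only on the abelianization. -/
theorem eq_of_abel_eq {H : Type*} [CommGroup H] (χ : FreeNilpotent c r →* H)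
    {x y : FreeNilpotent c r} (h : abel hc x = abel hc y) : χ x = χ y := by
  have h1 : χ = (AddMonoidHom.toMultiplicativeLeft (Fintype.linearCombination ℤ
      fun i => Additive.ofMul (χ (gen i))).toAddMonoidHom).comp (abel hc) :=
    hom_ext fun i => by
      rw [MonoidHom.comp_apply, abel_gen]
      change _ = (Fintype.linearCombination ℤ (fun i => Additive.ofMul (χ (gen i)))
        (Pi.single i 1)).toMul
      rw [Fintype.linearCombination_apply_single, one_smul, toMul_ofMul]
  rw [h1, MonoidHom.comp_apply, h, MonoidHom.comp_apply]

/-- A lift of a homomorphism between the abelianizations. -/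
noncomputable def liftHom (f : (Fin r → ℤ) →+ (Fin s → ℤ)) :
    FreeNilpotent c r →* FreeNilpotent c s :=
  lift (lcs_eq_bot c s) fun i =>
    Function.surjInv (abel_surjective hc) (Multiplicative.ofAdd (f (Pi.single i 1)))

theorem abel_liftHom (f : (Fin r → ℤ) →+ (Fin s → ℤ)) (x : FreeNilpotent c r) :
    abel hc (liftHom hc f x) = Multiplicative.ofAdd (f (abel hc x).toAdd) := by
  have h : (abel hc).comp (liftHom hc f) = (AddMonoidHom.toMultiplicative f).comp (abel hc) :=
    hom_ext fun i => by
      rw [MonoidHom.comp_apply, liftHom, lift_gen, MonoidHom.comp_apply, abel_gen]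
      exact Function.surjInv_eq (abel_surjective hc) _
  exact DFunLike.congr_fun h x

theorem map_one_eq_of_abel_eq {φ ψ : FreeNilpotent c r →* FreeNilpotent c s}
    (h : ∀ x, abel hc (φ x) = abel hc (ψ x)) : IntHomology.map φ 1 = IntHomology.map ψ 1 :=
  intHomology_one_hom_ext fun g => by
    rw [map_homologyClass, map_homologyClass, eq_of_abel_eq hc (homologyClass _) (h g)]

theorem map_one_eq_add {φ ψ χ : FreeNilpotent c r →* FreeNilpotent c s}
    (h : ∀ x, abel hc (χ x) = abel hc (φ x) * abel hc (ψ x)) :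
    IntHomology.map χ 1 = IntHomology.map φ 1 + IntHomology.map ψ 1 :=
  intHomology_one_hom_ext fun g => by
    rw [AddMonoidHom.add_apply, map_homologyClass, map_homologyClass, map_homologyClass,
      eq_of_abel_eq hc (homologyClass _) ((h g).trans (map_mul _ _ _).symm), map_mul, toAdd_mul]

variable (c s) in
/-- The free nilpotent group maps onto the quotient of its bar extension by the center. -/
noncomputable def toBarExtensionQuotient : FreeNilpotent c s →*
    BarExtension (FreeNilpotent c s) ⧸ Subgroup.center (BarExtension (FreeNilpotent c s)) :=
  MonoidHom.mk' (fun g => QuotientGroup.mk ⟨0, g⟩) fun g h => by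
    rw [← QuotientGroup.mk_mul, BarExtension.mk_mul_mk, QuotientGroup.mk_mul,
      (QuotientGroup.eq_one_iff _).2 (BarExtension.incl (bar g h)).toMul.2, one_mul]

theorem toBarExtensionQuotient_base (x : BarExtension (FreeNilpotent c s)) :
    toBarExtensionQuotient c s x.base = QuotientGroup.mk x := by
  conv_rhs => rw [BarExtension.eq_incl_mul x, QuotientGroup.mk_mul,
    (QuotientGroup.eq_one_iff _).2 (BarExtension.incl x.chain).toMul.2, one_mul]
  rfl

/-- The kernel of the projection to N is central, so the quotient by the centre is a quotient of N.
-/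
theorem lowerCentralSeries_quotient_center_barExtension (c s : ℕ) :
    (⊤ : Subgroup (BarExtension (FreeNilpotent c s) ⧸
      Subgroup.center (BarExtension (FreeNilpotent c s)))).lowerCentralSeries c = ⊥ := by
  have h : Function.Surjective (toBarExtensionQuotient c s) := fun x => by
    obtain ⟨x, rfl⟩ := QuotientGroup.mk_surjective x
    exact ⟨_, toBarExtensionQuotient_base x⟩
  have h1 := Subgroup.map_lowerCentralSeries (⊤ : Subgroup (FreeNilpotent c s))
    (toBarExtensionQuotient c s) c
  rw [Subgroup.map_top_of_surjective _ h, lcs_eq_bot, Subgroup.map_bot] at h1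
  exact h1.symm

/-- H₂ lies in Γ_{c+1} of the bar extension, where the induced homomorphisms depend on the
abelianization through (c+1)-fold commutators. -/
theorem isPolyMap_map_two {U : Type*} [AddCommGroup U]
    (φ : U → FreeNilpotent c r →* FreeNilpotent c s)
    (hφ : ∀ h h' x, abel hc (φ (h + h') x) = abel hc (φ h x) * abel hc (φ h' x)) :
    IsPolyMap (c + 1) fun h => IntHomology.map (φ h) 2 := by
  refine IsPolyMap.of_apply fun x => ?_
  obtain ⟨k, rfl⟩ : ∃ k, c = k + 1 := ⟨c - 1, by omega⟩
  obtain ⟨F, hF, hF'⟩ := lowerCentralSeries_succ_le_centralPolySubgroup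
    (lowerCentralSeries_quotient_center_barExtension (k + 1) s) (fun h => BarExtension.map (φ h))
    (fun y h h' => by
      simp only [← toBarExtensionQuotient_base, BarExtension.base_map]
      rw [← map_mul, ← map_mul]
      refine eq_of_abel_eq hc (Abelianization.of.comp (toBarExtensionQuotient (k + 1) s)) ?_
      rw [hφ, map_mul]) (incl_homologyToBarQuotient_mem x)
  -- Deviations may be tested in the centre of the bar extension, since H₂ embeds there naturally.
  refine IsPolyMap.of_injective (BarExtension.incl.comp (homologyToBarQuotient _))
    (BarExtension.incl_injective.comp (homologyToBarQuotient_injective _)) ?_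
  convert! hF using 2 with h
  refine Additive.toMul.injective (Subtype.ext ?_)
  rw [hF', AddMonoidHom.comp_apply, homologyToBarQuotient_map, ← BarExtension.map_incl]

theorem map_two_eq_of_abel_eq {φ ψ : FreeNilpotent c r →* FreeNilpotent c s}
    (h : ∀ x, abel hc (φ x) = abel hc (ψ x)) : IntHomology.map φ 2 = IntHomology.map ψ 2 := by
  ext x
  obtain ⟨k, rfl⟩ : ∃ k, c = k + 1 := ⟨c - 1, by omega⟩
  have h1 := (lowerCentralSeries_succ_le_eqLocus
    (lowerCentralSeries_quotient_center_barExtension (k + 1) s)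
    (BarExtension.map φ) (BarExtension.map ψ) (fun y => by
      rw [← toBarExtensionQuotient_base, ← toBarExtensionQuotient_base]
      exact eq_of_abel_eq hc (Abelianization.of.comp (toBarExtensionQuotient (k + 1) s))
        (h y.base)) (incl_homologyToBarQuotient_mem x)).1
  change BarExtension.map φ _ = BarExtension.map ψ _ at h1
  rw [BarExtension.map_incl, BarExtension.map_incl, ← homologyToBarQuotient_map,
    ← homologyToBarQuotient_map] at h1
  exact homologyToBarQuotient_injective _ (BarExtension.incl_injective
    (Additive.toMul.injective (Subtype.ext h1)))

end FreeNilpotent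

end NilpotentGroups

/-! ### Transposition, and Hom(H₁, H₂) as a functor of pairs -/

/-- The transpose of a homomorphism between free abelian groups. -/
def transposeHom {r s : ℕ} :
    ((Fin r → ℤ) →+ (Fin s → ℤ)) →+ ((Fin s → ℤ) →+ (Fin r → ℤ)) :=
  AddMonoidHom.mk' (fun g => AddMonoidHom.mk' (fun w i => g (Pi.single i 1) ⬝ᵥ w)
    fun _ _ => funext fun _ => dotProduct_add _ _ _)
    fun g g' => AddMonoidHom.ext fun w => funext fun i =>
      add_dotProduct (g (Pi.single i 1)) (g' (Pi.single i 1)) w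

section Transpose

variable {r s u : ℕ}

theorem transposeHom_apply (g : (Fin r → ℤ) →+ (Fin s → ℤ)) (w : Fin s → ℤ) (i : Fin r) :
    transposeHom g w i = g (Pi.single i 1) ⬝ᵥ w := rfl

theorem dotProduct_transposeHom (g : (Fin r → ℤ) →+ (Fin s → ℤ)) (v : Fin r → ℤ)
    (w : Fin s → ℤ) : v ⬝ᵥ transposeHom g w = g v ⬝ᵥ w := by
  conv_rhs => rw [← Finset.univ_sum_single v, map_sum, sum_dotProduct]
  refine Finset.sum_congr rfl fun i _ => ?_
  have h : (Pi.single i (v i) : Fin r → ℤ) = v i • Pi.single i 1 := by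
    rw [← Pi.single_smul, smul_eq_mul, mul_one]
  rw [h, map_zsmul, smul_dotProduct, transposeHom_apply, smul_eq_mul]

theorem transposeHom_comp (g : (Fin r → ℤ) →+ (Fin s → ℤ)) (g' : (Fin s → ℤ) →+ (Fin u → ℤ)) :
    transposeHom (g'.comp g) = (transposeHom g).comp (transposeHom g') :=
  AddMonoidHom.ext fun w => funext fun _ => (dotProduct_transposeHom g' _ w).symm

theorem transposeHom_id : transposeHom (AddMonoidHom.id (Fin r → ℤ)) = AddMonoidHom.id _ :=
  AddMonoidHom.ext fun w => funext fun _ => by simp [transposeHom_apply]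

theorem transposeHom_mulVecLin (A : Matrix (Fin r) (Fin r) ℤ) :
    transposeHom A.transpose.mulVecLin.toAddMonoidHom = A.mulVecLin.toAddMonoidHom :=
  AddMonoidHom.ext fun w => funext fun i => by
    simp [transposeHom_apply, Matrix.mulVec, Matrix.row]

end Transpose

namespace HomH1H2

variable {c r s u : ℕ}

theorem map_congr (hc : 1 ≤ c) {p p' : FreeNilpotent c s →* FreeNilpotent c r}
    {i i' : FreeNilpotent c r →* FreeNilpotent c s}
    (hp : ∀ x, FreeNilpotent.abel hc (p x) = FreeNilpotent.abel hc (p' x))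
    (hi : ∀ x, FreeNilpotent.abel hc (i x) = FreeNilpotent.abel hc (i' x)) :
    map p i = map p' i' := by
  refine MonoidHom.ext fun f => ?_
  change Multiplicative.ofAdd _ = Multiplicative.ofAdd _
  rw [FreeNilpotent.map_one_eq_of_abel_eq hc hp, FreeNilpotent.map_two_eq_of_abel_eq hc hi]

/-- The map on `Hom(H₁, H₂)` that is induced by a pair of homomorphisms between the
abelianizations, of which the second one is transposed. -/
noncomputable def mapPair (hc : 1 ≤ c)
    (f : ((Fin r → ℤ) →+ (Fin s → ℤ)) × ((Fin r → ℤ) →+ (Fin s → ℤ))) :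
    HomH1H2 c r →* HomH1H2 c s :=
  map (FreeNilpotent.liftHom hc (transposeHom f.2)) (FreeNilpotent.liftHom hc f.1)

theorem mapPair_eq_map (hc : 1 ≤ c)
    (f : ((Fin r → ℤ) →+ (Fin s → ℤ)) × ((Fin r → ℤ) →+ (Fin s → ℤ)))
    (p : FreeNilpotent c s →* FreeNilpotent c r) (i : FreeNilpotent c r →* FreeNilpotent c s)
    (hp : ∀ x, (FreeNilpotent.abel hc (p x)).toAdd =
      transposeHom f.2 (FreeNilpotent.abel hc x).toAdd)
    (hi : ∀ x, (FreeNilpotent.abel hc (i x)).toAdd = f.1 (FreeNilpotent.abel hc x).toAdd) :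
    mapPair hc f = map p i :=
  map_congr hc (fun x => by rw [FreeNilpotent.abel_liftHom, ← hp, ofAdd_toAdd])
    (fun x => by rw [FreeNilpotent.abel_liftHom, ← hi, ofAdd_toAdd])

theorem mapPair_id (hc : 1 ≤ c) (r : ℕ) :
    mapPair hc (AddMonoidHom.id (Fin r → ℤ), AddMonoidHom.id _) = MonoidHom.id _ := by
  rw [← map_id]
  exact mapPair_eq_map hc _ _ _ (fun x => by rw [transposeHom_id]; rfl) (fun x => rfl)

theorem mapPair_comp (hc : 1 ≤ c)
    (f : ((Fin r → ℤ) →+ (Fin s → ℤ)) × ((Fin r → ℤ) →+ (Fin s → ℤ)))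
    (g : ((Fin s → ℤ) →+ (Fin u → ℤ)) × ((Fin s → ℤ) →+ (Fin u → ℤ))) :
    mapPair hc (g.1.comp f.1, g.2.comp f.2) = (mapPair hc g).comp (mapPair hc f) := by
  rw [mapPair, mapPair, mapPair, map_comp]
  refine mapPair_eq_map hc _ _ _ (fun x => ?_) (fun x => ?_)
  · rw [MonoidHom.comp_apply, FreeNilpotent.abel_liftHom, FreeNilpotent.abel_liftHom,
      transposeHom_comp]
    rfl
  · rw [MonoidHom.comp_apply, FreeNilpotent.abel_liftHom, FreeNilpotent.abel_liftHom]
    rfl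

/-- The second entry is the inverse transpose, so transposing it gives back the inverse matrix, as
conjugation requires on H₁. -/
theorem mapPair_toGL (hc : 1 ≤ c) (α : MulAut (FreeNilpotent c r)) :
    mapPair hc ((pairHom (FreeNilpotent.toGL hc r α)).1.hom,
      (pairHom (FreeNilpotent.toGL hc r α)).2.hom) = conj α := by
  refine mapPair_eq_map hc _ _ _ (fun x => ?_) (fun x => ?_)
  · refine (FreeNilpotent.abel_apply hc (α⁻¹).toMonoidHom x).trans ?_
    refine (DFunLike.congr_fun (transposeHom_mulVecLin _) _).symm.trans ?_
    rw [pairHom, ← map_inv]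
    rfl
  · exact FreeNilpotent.abel_apply hc α.toMonoidHom x

/-- The transpose of the standard inclusion is the projection that kills the last coordinate, which
is the abelianization of `FreeNilpotent.proj`. -/
theorem mapPair_stdIncl (hc : 1 ≤ c) (r : ℕ) :
    mapPair hc (stdIncl r, stdIncl r) = stab c r := by
  refine mapPair_eq_map hc _ _ _ (fun x => ?_) (FreeNilpotent.abel_incl hc)
  have h : (FreeNilpotent.abel hc).comp (FreeNilpotent.proj c r) =
      (AddMonoidHom.toMultiplicative (transposeHom (stdIncl r))).comp (FreeNilpotent.abel hc) := by
    refine FreeNilpotent.hom_ext fun i => ?_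
    apply Multiplicative.toAdd.injective
    funext j
    refine Fin.lastCases ?_ (fun k => ?_) i <;>
      simp [transposeHom_apply, stdIncl, Pi.single_apply, eq_comm]
  exact congrArg Multiplicative.toAdd (DFunLike.congr_fun h x)

/-- Degree c + 1 from H₂ and degree 1 from H₁, combined by the bilinear operation (i, p) ↦ (κ ↦ i ∘
κ ∘ p). -/
theorem isPolyMap_mapPair (hc : 1 ≤ c) (r s : ℕ) :
    IsPolyMap (c + 2) fun f : ((Fin r → ℤ) →+ (Fin s → ℤ)) × ((Fin r → ℤ) →+ (Fin s → ℤ)) =>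
      Additive.ofMul (mapPair (c := c) hc f) := by
  let β : (IntHomology (FreeNilpotent c r) 2 →+ IntHomology (FreeNilpotent c s) 2) →+
      (IntHomology (FreeNilpotent c s) 1 →+ IntHomology (FreeNilpotent c r) 1) →+
      Additive (HomH1H2 c r →* HomH1H2 c s) :=
    AddMonoidHom.mk' (fun i => AddMonoidHom.mk' (fun p => Additive.ofMul
      (AddMonoidHom.toMultiplicative (AddMonoidHom.mk' (fun κ => (i.comp κ).comp p)
        fun κ κ' => by ext; simp)))
      fun p p' => Additive.toMul.injective (MonoidHom.ext fun κ =>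
        Multiplicative.toAdd.injective (AddMonoidHom.ext fun x => by
          change i (κ.toAdd (p x + p' x)) = i (κ.toAdd (p x)) + i (κ.toAdd (p' x))
          rw [map_add, map_add])))
      fun i i' => rfl
  let γ : ((Fin r → ℤ) →+ (Fin s → ℤ)) × ((Fin r → ℤ) →+ (Fin s → ℤ)) →+
      (IntHomology (FreeNilpotent c s) 1 →+ IntHomology (FreeNilpotent c r) 1) :=
    AddMonoidHom.mk' (fun f => IntHomology.map (FreeNilpotent.liftHom hc (transposeHom f.2)) 1)
      fun f f' => FreeNilpotent.map_one_eq_add hc fun x => by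
        simp only [FreeNilpotent.abel_liftHom, Prod.snd_add, map_add, AddMonoidHom.add_apply,
          ofAdd_add]
  have h2 : IsPolyMap (c + 1)
      fun f : ((Fin r → ℤ) →+ (Fin s → ℤ)) × ((Fin r → ℤ) →+ (Fin s → ℤ)) =>
        IntHomology.map (FreeNilpotent.liftHom (c := c) hc f.1) 2 :=
    FreeNilpotent.isPolyMap_map_two hc _ fun f f' x => by
      rw [FreeNilpotent.abel_liftHom, FreeNilpotent.abel_liftHom, FreeNilpotent.abel_liftHom]
      rfl
  exact h2.bilin (IsPolyMap.of_hom γ) β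

end HomH1H2

/-! ### Polynomial functors on the standard pairs -/

/-- The full subcategory of pairs of abelian groups on the standard pairs. -/
abbrev StdPairCat : Type := InducedCategory (AddCommGrpCat.{0} × AddCommGrpCat.{0}) stdPair

/-- The homology of `Hom(H₁, H₂)` with coefficients in a functor of pairs of abelian groups, as a
functor on the standard pairs. -/
noncomputable def stdHomologyFunctor {c : ℕ} (hc : 1 ≤ c) (t : ℕ)
    (F : AddCommGrpCat.{0} × AddCommGrpCat.{0} ⥤ AddCommGrpCat.{0}) :
    StdPairCat ⥤ AddCommGrpCat.{0} where
  obj r := AddCommGrpCat.of (TrivHomology (HomH1H2 c r) (F.obj (stdPair r)) t)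
  map f := AddCommGrpCat.ofHom (TrivHomology.map
    (HomH1H2.mapPair hc (f.hom.1.hom, f.hom.2.hom)) (F.map f.hom).hom t)
  map_id r := by
    have h : (F.map (𝟙 (stdPair r))).hom = AddMonoidHom.id _ := by rw [F.map_id]; rfl
    refine AddCommGrpCat.hom_ext ?_
    refine Eq.trans ?_ (TrivHomology.map_id t)
    exact congrArg₂ (fun a b => TrivHomology.map a b t) (HomH1H2.mapPair_id hc r) h
  map_comp f g := by
    have h : (F.map (f.hom ≫ g.hom)).hom = (F.map g.hom).hom.comp (F.map f.hom).hom := by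
      rw [F.map_comp]; rfl
    refine AddCommGrpCat.hom_ext ?_
    refine Eq.trans ?_ (TrivHomology.map_comp _ _ _ _ t)
    exact congrArg₂ (fun a b => TrivHomology.map a b t) (HomH1H2.mapPair_comp hc
      (f.hom.1.hom, f.hom.2.hom) (g.hom.1.hom, g.hom.2.hom)) h

/-- The morphism of standard pairs given by a pair of homomorphisms. -/
def stdPairHom {r s : ℕ} (f : ((Fin r → ℤ) →+ (Fin s → ℤ)) × ((Fin r → ℤ) →+ (Fin s → ℤ))) :
    stdPair r ⟶ stdPair s :=
  Prod.mkHom (AddCommGrpCat.ofHom f.1) (AddCommGrpCat.ofHom f.2)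

/-- A functor on the standard pairs is polynomial of degree at most `n` if it is polynomial of
degree at most `n` on morphisms. -/
def IsPolynomialOnStdPairs (T : StdPairCat ⥤ AddCommGrpCat.{0}) (n : ℕ) : Prop :=
  ∀ r s : ℕ, IsPolyMap n fun f : ((Fin r → ℤ) →+ (Fin s → ℤ)) × ((Fin r → ℤ) →+ (Fin s → ℤ)) =>
    T.map (X := r) (Y := s) ⟨stdPairHom f⟩

theorem isPolyMap_map_stdPairHom
    {F : AddCommGrpCat.{0} × AddCommGrpCat.{0} ⥤ AddCommGrpCat.{0}} {n : ℕ}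
    (hF : IsPolynomialOfDegreeLE F n) (r s : ℕ) : IsPolyMap n
      fun f : ((Fin r → ℤ) →+ (Fin s → ℤ)) × ((Fin r → ℤ) →+ (Fin s → ℤ)) =>
        F.map (stdPairHom f) := by
  refine IsPolyMap.of_fin fun u => ?_
  rw [← hF (fun i => AddCommGrpCat.ofHom (u i).1) (fun i => AddCommGrpCat.ofHom (u i).2)]
  refine Finset.sum_congr rfl fun S _ => ?_
  have h1 : ∀ v : Fin (n + 1) → ((Fin r → ℤ) →+ (Fin s → ℤ)),
      AddCommGrpCat.ofHom (∑ i ∈ S, v i) = ∑ i ∈ S, AddCommGrpCat.ofHom (v i) :=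
    fun v => map_sum (AddMonoidHom.mk' (AddCommGrpCat.ofHom (X := Fin r → ℤ) (Y := Fin s → ℤ))
      fun _ _ => rfl) v S
  rw [stdPairHom, Prod.fst_sum, Prod.snd_sum, h1, h1]

theorem isPolynomialOnStdPairs_stdHomologyFunctor {c : ℕ} (hc : 1 ≤ c) (t : ℕ)
    {F : AddCommGrpCat.{0} × AddCommGrpCat.{0} ⥤ AddCommGrpCat.{0}} {n : ℕ}
    (hF : IsPolynomialOfDegreeLE F n) :
    IsPolynomialOnStdPairs (stdHomologyFunctor hc t F) (t * (c + 2) + n) := by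
  intro r s
  let e : (F.obj (stdPair r) ⟶ F.obj (stdPair s)) →+ (F.obj (stdPair r) →+ F.obj (stdPair s)) :=
    AddMonoidHom.mk' (fun f => f.hom) fun _ _ => rfl
  let e' : (TrivHomology (HomH1H2 c r) (F.obj (stdPair r)) t →+
      TrivHomology (HomH1H2 c s) (F.obj (stdPair s)) t) →+
      (AddCommGrpCat.of (TrivHomology (HomH1H2 c r) (F.obj (stdPair r)) t) ⟶
        AddCommGrpCat.of (TrivHomology (HomH1H2 c s) (F.obj (stdPair s)) t)) :=
    AddMonoidHom.mk' AddCommGrpCat.ofHom fun _ _ => rfl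
  exact (TrivHomology.isPolyMap (HomH1H2.isPolyMap_mapPair hc r s)
    ((isPolyMap_map_stdPairHom hF r s).map e) t).map e'

/-! ### Extension to all pairs of abelian groups -/

section KanExtension

/-- A family of homomorphisms on a free abelian group factors through a single homomorphism on the
direct sum of copies of the group. -/
theorem exists_comp_inclusion_eq (r k : ℕ) :
    ∃ (m : ℕ) (j : Fin k → ((Fin r → ℤ) →+ (Fin m → ℤ))),
      ∀ (V : Type) [AddCommGroup V] (f : Fin k → ((Fin r → ℤ) →+ V)),
        ∃ p : (Fin m → ℤ) →+ V, ∀ i, p.comp (j i) = f i := by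
  let e : Fin k × Fin r ≃ Fin (k * r) := finProdFinEquiv
  let pr : Fin k → ((Fin (k * r) → ℤ) →+ (Fin r → ℤ)) := fun i =>
    AddMonoidHom.mk' (fun w l => w (e (i, l))) fun _ _ => rfl
  let j : Fin k → ((Fin r → ℤ) →+ (Fin (k * r) → ℤ)) := fun i =>
    AddMonoidHom.mk' (fun v x => if (e.symm x).1 = i then v (e.symm x).2 else 0) fun v v' => by
      ext x
      by_cases h : (e.symm x).1 = i <;> simp [h]
  have h1 : ∀ i v, pr i (j i v) = v := fun i v => funext fun l => by simp [pr, j]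
  have h2 : ∀ i i' v, i' ≠ i → pr i' (j i v) = 0 := fun i i' v h => funext fun l => by
    simp [pr, j, h]
  refine ⟨k * r, j, fun V _ f => ⟨∑ i, (f i).comp (pr i), fun i => AddMonoidHom.ext fun v => ?_⟩⟩
  rw [AddMonoidHom.comp_apply, AddMonoidHom.finsetSum_apply, Finset.sum_eq_single i]
  · rw [AddMonoidHom.comp_apply, h1]
  · intro i' _ h
    rw [AddMonoidHom.comp_apply, h2 i i' v h, map_zero]
  · simp

/-- The left Kan extension of a functor on the standard pairs. -/
noncomputable abbrev kanExtension (T : StdPairCat ⥤ AddCommGrpCat.{0}) :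
    AddCommGrpCat.{0} × AddCommGrpCat.{0} ⥤ AddCommGrpCat.{0} :=
  (inducedFunctor stdPair).pointwiseLeftKanExtension T

/-- The unit of the left Kan extension. -/
noncomputable abbrev kanExtensionUnit (T : StdPairCat ⥤ AddCommGrpCat.{0}) :
    T ⟶ inducedFunctor stdPair ⋙ kanExtension T :=
  (inducedFunctor stdPair).pointwiseLeftKanExtensionUnit T

/-- Left Kan extension along a fully faithful functor restricts to the original functor. -/
instance (T : StdPairCat ⥤ AddCommGrpCat.{0}) : IsIso (kanExtensionUnit T) :=
  ((inducedFunctor stdPair).pointwiseLeftKanExtensionIsPointwiseLeftKanExtension T).isIso_hom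

/-- The value at X is a colimit over the standard pairs mapping to X. -/
theorem kanExtension_hom_ext {T : StdPairCat ⥤ AddCommGrpCat.{0}}
    {X : AddCommGrpCat.{0} × AddCommGrpCat.{0}} {V : AddCommGrpCat.{0}}
    {f g : (kanExtension T).obj X ⟶ V}
    (h : ∀ (r : ℕ) (φ : stdPair r ⟶ X),
      (kanExtensionUnit T).app r ≫ (kanExtension T).map φ ≫ f =
        (kanExtensionUnit T).app r ≫ (kanExtension T).map φ ≫ g) : f = g := by
  refine ((inducedFunctor stdPair).pointwiseLeftKanExtensionIsPointwiseLeftKanExtension T X).hom_ext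
    fun φ => ?_
  exact (Category.assoc _ _ _).trans ((h φ.left φ.hom).trans (Category.assoc _ _ _).symm)

/-- The left Kan extension of a polynomial functor on the standard pairs is polynomial. -/
theorem isPolynomialOfDegreeLE_kanExtension {T : StdPairCat ⥤ AddCommGrpCat.{0}} {n : ℕ}
    (hT : IsPolynomialOnStdPairs T n) : IsPolynomialOfDegreeLE (kanExtension T) n := by
  intro A A' B B' f g
  refine kanExtension_hom_ext fun r φ => ?_
  -- Both entries of a standard pair are ℤ^r, so the same inclusions j serve for both. The maps p
  -- and q assemble the f i and the g i after φ, which transfers the deviation to the morphisms (j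
  -- i, j i) of standard pairs, where T is polynomial.
  obtain ⟨m, j, hj⟩ := exists_comp_inclusion_eq r (n + 1)
  obtain ⟨p, hp⟩ := hj A' fun i => (f i).hom.comp φ.1.hom
  obtain ⟨q, hq⟩ := hj B' fun i => (g i).hom.comp φ.2.hom
  have h1 : ∀ S : Finset (Fin (n + 1)), φ ≫ Prod.mkHom (∑ i ∈ S, f i) (∑ i ∈ S, g i) =
      stdPairHom (∑ i ∈ S, (j i, j i)) ≫ Prod.mkHom (AddCommGrpCat.ofHom p)
        (AddCommGrpCat.ofHom q) := by
    intro S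
    have h3 : ∀ {C C' : AddCommGrpCat.{0}} (f : Fin (n + 1) → (C ⟶ C'))
        (φ : AddCommGrpCat.of (Fin r → ℤ) ⟶ C) (p : (Fin m → ℤ) →+ C')
        (hp : ∀ i, p.comp (j i) = (f i).hom.comp φ.hom), φ ≫ ∑ i ∈ S, f i =
        AddCommGrpCat.ofHom (∑ i ∈ S, j i) ≫ AddCommGrpCat.ofHom p := by
      intro C C' f φ p hp
      rw [Preadditive.comp_sum]
      refine AddCommGrpCat.hom_ext (AddMonoidHom.ext fun v => ?_)
      change AddCommGrpCat.homAddEquiv (∑ i ∈ S, φ ≫ f i) v = p ((∑ i ∈ S, j i) v)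
      rw [map_sum, AddMonoidHom.finsetSum_apply, AddMonoidHom.finsetSum_apply, map_sum]
      exact Finset.sum_congr rfl fun i _ => (DFunLike.congr_fun (hp i) v).symm
    rw [stdPairHom, Prod.fst_sum, Prod.snd_sum]
    exact Prod.ext (h3 f φ.1 p hp) (h3 g φ.2 q hq)
  have h2 := (hT r m).sum_univ fun i => (j i, j i)
  have h4 : ∀ u, (kanExtensionUnit T).app r ≫ (kanExtension T).map (stdPairHom u) =
      T.map (X := r) (Y := m) ⟨stdPairHom u⟩ ≫ (kanExtensionUnit T).app m := fun u =>
    ((kanExtensionUnit T).naturality (X := r) (Y := m) ⟨stdPairHom u⟩).symm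
  rw [Limits.comp_zero, Limits.comp_zero, Preadditive.comp_sum, Preadditive.comp_sum]
  have h5 : ∀ S : Finset (Fin (n + 1)), (kanExtensionUnit T).app r ≫ (kanExtension T).map φ ≫
      ((-1 : ℤ) ^ S.card • (kanExtension T).map (Prod.mkHom (∑ i ∈ S, f i) (∑ i ∈ S, g i))) =
      ((-1 : ℤ) ^ S.card • T.map (X := r) (Y := m) ⟨stdPairHom (∑ i ∈ S, (j i, j i))⟩) ≫
        (kanExtensionUnit T).app m ≫ (kanExtension T).map (Prod.mkHom (AddCommGrpCat.ofHom p)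
        (AddCommGrpCat.ofHom q)) := by
    intro S
    rw [Preadditive.comp_zsmul, Preadditive.comp_zsmul, Preadditive.zsmul_comp, ← Functor.map_comp,
      h1, Functor.map_comp, ← Category.assoc, h4, Category.assoc]
  rw [Finset.sum_congr rfl fun S _ => h5 S, ← Preadditive.sum_comp, h2, Limits.zero_comp]

end KanExtension

/-! ### Transport along isomorphisms and conclusion -/

/-- The map on homology induced by isomorphisms of the coefficients. -/
noncomputable def TrivHomology.coeffEquiv (K : Type) [Group K] {A A' : Type} [AddCommGroup A]
    [AddCommGroup A'] (e : A ≃+ A') (t : ℕ) : TrivHomology K A t ≃+ TrivHomology K A' t :=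
  AddMonoidHom.toAddEquiv (TrivHomology.map (MonoidHom.id K) e.toAddMonoidHom t)
    (TrivHomology.map (MonoidHom.id K) e.symm.toAddMonoidHom t)
    (by
      rw [← TrivHomology.map_comp]
      refine Eq.trans ?_ (TrivHomology.map_id t)
      congr 1
      exact AddMonoidHom.ext fun x => e.symm_apply_apply x)
    (by
      rw [← TrivHomology.map_comp]
      refine Eq.trans ?_ (TrivHomology.map_id t)
      congr 1
      exact AddMonoidHom.ext fun x => e.apply_symm_apply x)

theorem SeqModule.IsIsomorphic.trans {G : GroupSeq} {M N P : SeqModule G}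
    (h : M.IsIsomorphic N) (h' : N.IsIsomorphic P) : M.IsIsomorphic P := by
  obtain ⟨e, h1, h2⟩ := h
  obtain ⟨e', h1', h2'⟩ := h'
  exact ⟨fun r => (e r).trans (e' r), fun r g x => by simp [h1, h1'], fun r x => by simp [h2, h2']⟩

theorem SeqModule.IsIsomorphic.restrict {G H : GroupSeq} (q : G.Hom H) {M N : SeqModule H}
    (h : M.IsIsomorphic N) : (M.restrict q).IsIsomorphic (N.restrict q) := by
  obtain ⟨e, h1, h2⟩ := h
  exact ⟨e, fun r g x => h1 r (q.app r g) x, h2⟩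

theorem SeqModule.IsIsomorphic.homologyModule {c : ℕ} (t : ℕ) {M N : SeqModule (AutSeq c)}
    (h : M.IsIsomorphic N) : (homologyModule c t M).IsIsomorphic (homologyModule c t N) := by
  obtain ⟨e, h1, h2⟩ := h
  have key : ∀ {K K' A A' B B' : Type} [Group K] [Group K'] [AddCommGroup A] [AddCommGroup A']
      [AddCommGroup B] [AddCommGroup B'] (f : K →* K') (a : A →+ A') (b : B →+ B') (e : A ≃+ B)
      (e' : A' ≃+ B') (h : ∀ x, e' (a x) = b (e x)) (x : TrivHomology K A t),
      TrivHomology.coeffEquiv K' e' t (TrivHomology.map f a t x) =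
        TrivHomology.map f b t (TrivHomology.coeffEquiv K e t x) := by
    intro K K' A A' B B' _ _ _ _ _ _ f a b e e' h x
    have h3 := TrivHomology.map_comp f (MonoidHom.id K') a e'.toAddMonoidHom t
    have h4 := TrivHomology.map_comp (MonoidHom.id K) f e.toAddMonoidHom b t
    have h5 : e'.toAddMonoidHom.comp a = b.comp e.toAddMonoidHom := AddMonoidHom.ext h
    rw [h5] at h3
    exact (DFunLike.congr_fun h3 x).symm.trans (DFunLike.congr_fun h4 x)
  exact ⟨fun r => TrivHomology.coeffEquiv _ (e r) t,
    fun r g x => key (HomH1H2.conj g) _ _ _ _ (h1 r g) x, fun r x => key _ _ _ _ _ (h2 r) x⟩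

/-- The homology of `Hom(H₁, H₂)` with coefficients in the module given by a functor is the module
given by the left Kan extension. -/
theorem homologyModule_functorModule_isIsomorphic {c : ℕ} (hc : 1 ≤ c) (t : ℕ)
    (F : AddCommGrpCat.{0} × AddCommGrpCat.{0} ⥤ AddCommGrpCat.{0}) :
    (homologyModule c t ((functorModule F).restrict (autToGL hc))).IsIsomorphic
      ((functorModule (kanExtension (stdHomologyFunctor hc t F))).restrict (autToGL hc)) := by
  let T := stdHomologyFunctor hc t F
  let η : ∀ r : ℕ, T.obj r ≅ (kanExtension T).obj (stdPair r) := fun r =>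
    asIso ((kanExtensionUnit T).app r)
  have hη : ∀ {r s : ℕ} (f : stdPair r ⟶ stdPair s) (x : T.obj r),
      (η s).hom (T.map (X := r) (Y := s) ⟨f⟩ x) = (kanExtension T).map f ((η r).hom x) :=
    fun {r s} f x => ConcreteCategory.congr_hom
      ((kanExtensionUnit T).naturality (X := r) (Y := s) ⟨f⟩) x
  refine ⟨fun r => (η r).addCommGroupIsoToAddEquiv, fun r g x => ?_, fun r x => ?_⟩
  · refine Eq.trans (congrArg (η r).hom ?_) (hη (pairHom (FreeNilpotent.toGL hc r g)) x)
    exact congrArg (fun f => TrivHomology.map f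
      (F.map (pairHom (FreeNilpotent.toGL hc r g))).hom t x) (HomH1H2.mapPair_toGL hc g).symm
  · refine Eq.trans (congrArg (η (r + 1)).hom ?_) (hη (pairIncl r) x)
    exact congrArg (fun f => TrivHomology.map f (F.map (pairIncl r)).hom t x)
      (HomH1H2.mapPair_stdIncl hc r).symm

theorem proposition4p1 (c : ℕ) (hc : 1 ≤ c) (t : ℕ) (M : SeqModule (AutSeq c))
    (hM : IsPolynomialAutModule hc M) :
    IsPolynomialAutModule hc (homologyModule c t M) := by
  obtain ⟨P, ⟨F, ⟨n, hF⟩, hPF⟩, hMP⟩ := hM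
  refine ⟨functorModule (kanExtension (stdHomologyFunctor hc t F)), ⟨_, ⟨_,
    isPolynomialOfDegreeLE_kanExtension (isPolynomialOnStdPairs_stdHomologyFunctor hc t hF)⟩,
    fun r => AddEquiv.refl _, fun r g x => rfl, fun r x => rfl⟩, ?_⟩
  exact ((hMP.trans (hPF.restrict _)).homologyModule t).trans
    (homologyModule_functorModule_isIsomorphic hc t F)
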